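/- **Conventions.** All matrices are complex and $p\ge 0$, $n\ge 0$ are integers. A rational $p\times p$ matrix function $G(z)$ is *lossless* if at each of its points of analyticity $z$ one has $G(z)^*G(z)\ge I$ for $|z|<1$, $G(z)^*G(z)=I$ for $|z|=1$, and $G(z)^*G(z)\le I$ for $|z|>1$. Its *McMillan degree* is the smallest $n$ for which $G(z)=D+C(zI_n-A)^{-1}B$ for some constant matrices $A\in\mathbb C^{n\times n}$, $B$, $C$, $D$. Let $J=\begin{pmatrix}I_p&0\\0&-I_p\end{pmatrix}$; a constant $2p\times 2p$ matrix $M$ is *$J$-unitary* if $M^*JM=J$. Put $b_w(z)=\dfrac{z-w}{1-\overline w z}$ and, for $|w|<1$, $|\xi|=1$, $u,v\in\mathbb C^p$ with $\|u\|=1$, $\|v\|<1$, and $H$ $J$-unitary, $$\Theta(u,v,w,\xi,H)(z)=\left(I_{2p}+\Big(\frac{b_w(z)}{b_w(\xi)}-1\Big)\frac{\begin{pmatrix}u\\v\end{pmatrix}\begin{pmatrix}u\\v\end{pmatrix}^{*}J}{1-\|v\|^2}\right)H .$$ For an invertible rational $2p\times 2p$ matrix $\Theta=\begin{pmatrix}\Theta_1&\Theta_2\\\Theta_3&\Theta_4\end{pmatrix}$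 with $p\times p$ blocks let $\mathcal T_\Theta(G)=(\Theta_4G+\Theta_3)(\Theta_2G+\Theta_1)^{-1}$, with domain $\mathcal M_\Theta$ the set of all rational $p\times p$ matrices $G$ for which $\Theta_2G+\Theta_1$ is invertible as a rational matrix; $\mathcal T_\Theta^{-1}$ is the inverse of this injective map. For $w=0$ the point $1/\overline w$ is $\infty$. **Theorem (Tangential Schur algorithm).** Let $G^{(n)}$ be a $p\times p$ lossless function of McMillan degree $n$. For $k=n,\dots,1$ let $w_k\in\mathbb C$ with $|w_k|<1$ and $\xi_k\in\mathbb C$ with $|\xi_k|=1$ be given, together with a map $H_k$ that assigns a constant $J$-unitary $2p\times 2p$ matrix $H_k(u,v,w,\xi)$ to each $(u,v,w,\xi)\in\mathbb C^p\times\mathbb C^p\times\mathbb C\times\mathbb C$ with $\|u\|=1$, $\|v\|<1$, $|w|<1$, $|\xi|=1$. For vectors $u_n,\dots,u_1\in\mathbb C^p$ define recursively, for $k=n,\dots,1$, $$v_k=G^{(k)}(1/\overline{w}_k)\,u_k,\qquad \Theta_k=\Theta\big(u_k,v_k,w_k,\xi_k,H_k(u_k,v_k,w_k,\xi_k)\big),\qquad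 G^{(k-1)}=\mathcal T_{\Theta_k}^{-1}(G^{(k)}).$$ 1. There are vectors $u_n,\dots,u_1$ with $\|u_k\|=1$ and $\|v_k\|<1$ for all $k=n,\dots,1$. They can be chosen one after the other: whenever $1\le k\le n$ and $u_n,\dots,u_{k+1}$ have been chosen with $\|u_j\|=1$ and $\|v_j\|<1$ for $j=n,\dots,k+1$, there is $u_k$ with $\|u_k\|=1$ and $\|v_k\|<1$. 2. For every choice of $u_n,\dots,u_1$ with $\|u_k\|=1$ and $\|v_k\|<1$ for all $k=n,\dots,1$: each $G^{(k)}$, $0\le k\le n$, is lossless of McMillan degree $k$; for $1\le k\le n$, $G^{(k)}$ is analytic at $1/\overline{w}_k$, $G^{(k-1)}\in\mathcal M_{\Theta_k}$ and $\mathcal T_{\Theta_k}(G^{(k-1)})=G^{(k)}$; moreover $G^{(0)}\in\mathcal M_{\Theta_n\Theta_{n-1}\cdots\Theta_1}$ and $$G^{(n)}=\mathcal T_{\Theta_n}\big(\mathcal T_{\Theta_{n-1}}(\cdots(\mathcal T_{\Theta_1}(G^{(0)}))\cdots)\big)=\mathcal T_{\Theta_n\Theta_{n-1}\cdots\Theta_1}(G^{(0)}),$$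 and $G^{(0)}$ is a constant unitary matrix. -/

import Mathlib

open scoped ComplexOrder ComplexConjugate

noncomputable section

namespace TangentialSchur

/-- Rational matrix functions of one complex variable. Two rational functions which agree almost
everywhere are the same element of `RatFunc ℂ` (common factors are cancelled). -/
abbrev RatMat (m n : Type) : Type := Matrix m n (RatFunc ℂ)

/-- Column vectors of length `p`, with the Euclidean norm. -/
abbrev Vec (p : ℕ) : Type := EuclideanSpace ℂ (Fin p)

/-- A constant matrix, regarded as a rational matrix function. -/
def const {m n : Type} (M : Matrix m n ℂ) : RatMat m n := M.map (fun c : ℂ => (RatFunc.C c))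

/-! ### Values of rational functions on the Riemann sphere -/

/-- `f` is analytic at the point `z` of the Riemann sphere `ℂ ∪ {∞}`: its reduced denominator does
not vanish at `z`, respectively its numerator has degree at most that of its denominator. -/
def AnalyticAtPt (f : RatFunc ℂ) : OnePoint ℂ → Prop
  | none => f.num.natDegree ≤ f.denom.natDegree
  | some z => f.denom.eval z ≠ 0

/-- The value of `f` at a point `z` of the Riemann sphere at which it is analytic. At `∞` this is
the limit of `f`, the quotient of the coefficients of degree `f.denom.natDegree`. -/
def valueAt (f : RatFunc ℂ) : OnePoint ℂ → ℂ
  | none => f.num.coeff f.denom.natDegree / f.denom.leadingCoeff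
  | some z => f.num.eval z / f.denom.eval z

/-- A rational matrix function is analytic at a point if all of its entries are. -/
def MatAnalyticAt {m n : Type} (G : RatMat m n) (z : OnePoint ℂ) : Prop :=
  ∀ i j, AnalyticAtPt (G i j) z

/-- The value of a rational matrix function at a point of the Riemann sphere. -/
def matValueAt {m n : Type} (G : RatMat m n) (z : OnePoint ℂ) : Matrix m n ℂ :=
  Matrix.of fun i j => valueAt (G i j) z

/-- The point `1 / conj w` of the Riemann sphere; it is `∞` for `w = 0`. -/
def invConj (w : ℂ) : OnePoint ℂ :=
  if w = 0 then OnePoint.infty else ((1 / conj w : ℂ) : OnePoint ℂ)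

/-! ### `Σ`-inner and lossless functions -/

/-- `Θ` is `S`-inner (in the unit disk): at all its points of analyticity `z` one has
`Θ(z)* S Θ(z) ≤ S` if `|z| < 1`, `= S` if `|z| = 1` and `≥ S` if `|z| > 1`. -/
structure IsInner {m : Type} [Fintype m] (S : Matrix m m ℂ) (Θ : RatMat m m) : Prop where
  inside : ∀ z : ℂ, ‖z‖ < 1 → MatAnalyticAt Θ z →
    (S - (matValueAt Θ z).conjTranspose * S * matValueAt Θ z).PosSemidef
  circle : ∀ z : ℂ, ‖z‖ = 1 → MatAnalyticAt Θ z →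
    (matValueAt Θ z).conjTranspose * S * matValueAt Θ z = S
  outside : ∀ z : ℂ, 1 < ‖z‖ → MatAnalyticAt Θ z →
    ((matValueAt Θ z).conjTranspose * S * matValueAt Θ z - S).PosSemidef

/-- A lossless function (discrete-time stable all-pass) is a `(-I)`-inner function. -/
def IsLossless {p : ℕ} (G : RatMat (Fin p) (Fin p)) : Prop :=
  IsInner (-1 : Matrix (Fin p) (Fin p) ℂ) G

/-! ### State-space realizations and the McMillan degree -/

/-- `G` has a state-space realization of dimension `n`: `G(z) = D + C (z I - A)⁻¹ B` with constant
matrices `A`, `B`, `C`, `D` and `A` of size `n × n`. -/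
def HasRealization {p q : ℕ} (G : RatMat (Fin p) (Fin q)) (n : ℕ) : Prop :=
  ∃ (A : Matrix (Fin n) (Fin n) ℂ) (B : Matrix (Fin n) (Fin q) ℂ)
    (C : Matrix (Fin p) (Fin n) ℂ) (D : Matrix (Fin p) (Fin q) ℂ),
    G = const D + const C *
      ((RatFunc.X : RatFunc ℂ) • (1 : RatMat (Fin n) (Fin n)) - const A)⁻¹ * const B

/-- The (proper) function `G` has McMillan degree `n`: `n` is the smallest dimension of a
state-space realization of `G`. -/
def HasMcMillanDegree {p q : ℕ} (G : RatMat (Fin p) (Fin q)) (n : ℕ) : Prop :=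
  IsLeast {d : ℕ | HasRealization G d} n

/-! ### `J`-unitary matrices and elementary `J`-inner factors -/

/-- The signature matrix `J = diag(I_p, -I_p)`. -/
def J (p : ℕ) : Matrix (Fin p ⊕ Fin p) (Fin p ⊕ Fin p) ℂ :=
  Matrix.fromBlocks 1 0 0 (-1)

/-- A constant `2p × 2p` matrix is `J`-unitary. -/
def IsJUnitary {p : ℕ} (M : Matrix (Fin p ⊕ Fin p) (Fin p ⊕ Fin p) ℂ) : Prop :=
  M.conjTranspose * J p * M = J p

/-- The Blaschke factor `b_w(z) = (z - w) / (1 - conj w * z)` as a rational function of `z`. -/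
def blaschke (w : ℂ) : RatFunc ℂ :=
  (RatFunc.X - RatFunc.C w) / (1 - RatFunc.C (conj w) * RatFunc.X)

/-- The number `b_w(z) = (z - w) / (1 - conj w * z)`. -/
def blaschkeVal (w z : ℂ) : ℂ := (z - w) / (1 - conj w * z)

/-- The column vector of length `2p` with blocks `u` and `v`. -/
def stack {p : ℕ} (u v : Vec p) : Fin p ⊕ Fin p → ℂ := Sum.elim (fun i => u i) (fun i => v i)

/-- The elementary `J`-inner factor
`Θ(u,v,w,ξ,H)(z) = (I + (b_w(z) / b_w(ξ) - 1) x x* J / (1 - ‖v‖²)) H`, where `x = [u; v]`. -/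
def theta {p : ℕ} (u v : Vec p) (w ξ : ℂ) (H : Matrix (Fin p ⊕ Fin p) (Fin p ⊕ Fin p) ℂ) :
    RatMat (Fin p ⊕ Fin p) (Fin p ⊕ Fin p) :=
  (1 + (blaschke w / RatFunc.C (blaschkeVal w ξ) - 1) •
      const ((1 / (1 - (‖v‖ : ℂ) ^ 2)) •
        (Matrix.vecMulVec (stack u v) (star (stack u v)) * J p))) * const H

/-! ### Linear fractional transformations -/

/-- The denominator `Θ₂ G + Θ₁` of the linear fractional transformation of `Θ`. -/
def lftDenom {p : ℕ} (Θ : RatMat (Fin p ⊕ Fin p) (Fin p ⊕ Fin p))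
    (G : RatMat (Fin p) (Fin p)) : RatMat (Fin p) (Fin p) :=
  Θ.toBlocks₁₂ * G + Θ.toBlocks₁₁

/-- The domain of the linear fractional transformation of `Θ`: those `G` for which `Θ₂ G + Θ₁`
has full rank. -/
def lftDomain {p : ℕ} (Θ : RatMat (Fin p ⊕ Fin p) (Fin p ⊕ Fin p)) :
    Set (RatMat (Fin p) (Fin p)) :=
  {G | IsUnit (lftDenom Θ G)}

/-- The linear fractional transformation `G ↦ (Θ₄ G + Θ₃) (Θ₂ G + Θ₁)⁻¹`. -/
def lft {p : ℕ} (Θ : RatMat (Fin p ⊕ Fin p) (Fin p ⊕ Fin p))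
    (G : RatMat (Fin p) (Fin p)) : RatMat (Fin p) (Fin p) :=
  (Θ.toBlocks₂₂ * G + Θ.toBlocks₂₁) * (lftDenom Θ G)⁻¹

/-- The inverse of the map `lft Θ`, which for invertible `Θ` is injective on its domain
`lftDomain Θ`. -/
def lftInv {p : ℕ} (Θ : RatMat (Fin p ⊕ Fin p) (Fin p ⊕ Fin p)) :
    RatMat (Fin p) (Fin p) → RatMat (Fin p) (Fin p) :=
  Function.invFunOn (lft Θ) (lftDomain Θ)

/-- The composition of the linear fractional transformations of `Θ k`, …, `Θ 1`, the one of `Θ 1`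
being applied first. -/
def lftComp {p : ℕ} (Θ : ℕ → RatMat (Fin p ⊕ Fin p) (Fin p ⊕ Fin p)) :
    ℕ → RatMat (Fin p) (Fin p) → RatMat (Fin p) (Fin p)
  | 0, G => G
  | k + 1, G => lft (Θ (k + 1)) (lftComp Θ k G)

/-- The product `Θ k * ⋯ * Θ 2 * Θ 1`. -/
def thetaProd {p : ℕ} (Θ : ℕ → RatMat (Fin p ⊕ Fin p) (Fin p ⊕ Fin p)) :
    ℕ → RatMat (Fin p ⊕ Fin p) (Fin p ⊕ Fin p)
  | 0 => 1
  | k + 1 => Θ (k + 1) * thetaProd Θ k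

/-! ### The recursion -/

/-- The vector `G(1 / conj w) u`. -/
def schurVec {p : ℕ} (G : RatMat (Fin p) (Fin p)) (w : ℂ) (u : Vec p) : Vec p :=
  WithLp.toLp 2 ((matValueAt G (invConj w)).mulVec (fun i => u i))

/-- The elementary factor `Θ(u, v, w, ξ, H(u, v, w, ξ))` with `v = G(1 / conj w) u`. -/
def schurFactor {p : ℕ} (G : RatMat (Fin p) (Fin p)) (w ξ : ℂ)
    (H : Vec p → Vec p → ℂ → ℂ → Matrix (Fin p ⊕ Fin p) (Fin p ⊕ Fin p) ℂ) (u : Vec p) :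
    RatMat (Fin p ⊕ Fin p) (Fin p ⊕ Fin p) :=
  theta u (schurVec G w u) w ξ (H u (schurVec G w u) w ξ)

/-- `schurDown … j` is the function `G^(n - j)` reached from `G^(n) = G` after `j` steps. -/
def schurDown {p : ℕ} (n : ℕ) (G : RatMat (Fin p) (Fin p)) (w ξ : ℕ → ℂ)
    (H : ℕ → Vec p → Vec p → ℂ → ℂ → Matrix (Fin p ⊕ Fin p) (Fin p ⊕ Fin p) ℂ)
    (u : ℕ → Vec p) : ℕ → RatMat (Fin p) (Fin p)
  | 0 => G
  | j + 1 =>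
    let G' := schurDown n G w ξ H u j
    lftInv (schurFactor G' (w (n - j)) (ξ (n - j)) (H (n - j)) (u (n - j))) G'

/-- The function `G^(k)`, for `0 ≤ k ≤ n`. -/
def schurG {p : ℕ} (n : ℕ) (G : RatMat (Fin p) (Fin p)) (w ξ : ℕ → ℂ)
    (H : ℕ → Vec p → Vec p → ℂ → ℂ → Matrix (Fin p ⊕ Fin p) (Fin p ⊕ Fin p) ℂ)
    (u : ℕ → Vec p) (k : ℕ) : RatMat (Fin p) (Fin p) :=
  schurDown n G w ξ H u (n - k)

/-- The Schur vector `v_k = G^(k)(1 / conj w_k) u_k`, for `1 ≤ k ≤ n`. -/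
def schurV {p : ℕ} (n : ℕ) (G : RatMat (Fin p) (Fin p)) (w ξ : ℕ → ℂ)
    (H : ℕ → Vec p → Vec p → ℂ → ℂ → Matrix (Fin p ⊕ Fin p) (Fin p ⊕ Fin p) ℂ)
    (u : ℕ → Vec p) (k : ℕ) : Vec p :=
  schurVec (schurG n G w ξ H u k) (w k) (u k)

/-- The factor `Θ_k = Θ(u_k, v_k, w_k, ξ_k, H_k(u_k, v_k, w_k, ξ_k))`, for `1 ≤ k ≤ n`. -/
def schurTheta {p : ℕ} (n : ℕ) (G : RatMat (Fin p) (Fin p)) (w ξ : ℕ → ℂ)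
    (H : ℕ → Vec p → Vec p → ℂ → ℂ → Matrix (Fin p ⊕ Fin p) (Fin p ⊕ Fin p) ℂ)
    (u : ℕ → Vec p) (k : ℕ) : RatMat (Fin p ⊕ Fin p) (Fin p ⊕ Fin p) :=
  theta (u k) (schurV n G w ξ H u k) (w k) (ξ k)
    (H k (u k) (schurV n G w ξ H u k) (w k) (ξ k))

/-- The recursion starts at `G^(n) = G`. -/
theorem schurG_top {p : ℕ} (n : ℕ) (G : RatMat (Fin p) (Fin p)) (w ξ : ℕ → ℂ)
    (H : ℕ → Vec p → Vec p → ℂ → ℂ → Matrix (Fin p ⊕ Fin p) (Fin p ⊕ Fin p) ℂ)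
    (u : ℕ → Vec p) : schurG n G w ξ H u n = G := by
  simp [schurG, schurDown]

/-- The recursion step: `G^(k-1)` is the image of `G^(k)` under the inverse of `lft Θ_k`. -/
theorem schurG_step {p : ℕ} (n : ℕ) (G : RatMat (Fin p) (Fin p)) (w ξ : ℕ → ℂ)
    (H : ℕ → Vec p → Vec p → ℂ → ℂ → Matrix (Fin p ⊕ Fin p) (Fin p ⊕ Fin p) ℂ)
    (u : ℕ → Vec p) (k : ℕ) (hk : 1 ≤ k) (hkn : k ≤ n) :
    schurG n G w ξ H u (k - 1) =
      lftInv (schurTheta n G w ξ H u k) (schurG n G w ξ H u k) := by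
  have h1 : n - (k - 1) = (n - k) + 1 := by omega
  have h2 : n - (n - k) = k := by omega
  simp only [schurG, schurTheta, schurV, h1, schurDown, h2, schurFactor]

/-- The choice `u` of direction vectors is admissible at level `k`: `‖u_k‖ = 1` and the resulting
Schur vector satisfies `‖v_k‖ < 1`. -/
def Admissible {p : ℕ} (n : ℕ) (G : RatMat (Fin p) (Fin p)) (w ξ : ℕ → ℂ)
    (H : ℕ → Vec p → Vec p → ℂ → ℂ → Matrix (Fin p ⊕ Fin p) (Fin p ⊕ Fin p) ℂ)
    (u : ℕ → Vec p) (k : ℕ) : Prop :=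
  ‖u k‖ = 1 ∧ ‖schurV n G w ξ H u k‖ < 1

end TangentialSchur

end

open TangentialSchur

/-! A function is lossless exactly when it has a realization whose matrix `[A B; C D]` is isometric:
with state `s` and input `c` at the point `z`, energy conservation reads `‖c‖² - ‖G(z)c‖² = (|z|² -
1)‖s‖²`. Every step of the algorithm becomes a statement about conservation of energy.

From lossless to isometric (`IsLossless.isometricRealization`): a lossless function has no poles
outside the open disk, so the state matrix of a minimal realization is stable and the Stein equation
`C*C + A*XA = X` has a solution `X = L*L`. The identity `G*G = I` on the circle, a Liouville
argument and controllability give the remaining block equations that make `[A B; C D]` isometric for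
the state norm `‖Lx‖`. The lurking isometry (`isometricRealization_of_energy`) turns any
energy-preserving relation of this kind into an honest isometric realization on the same state
space.

Choice of `u`: let `φ = conj w Aφ + Bu` be the rescaled state at `1 / conj w`. Energy conservation
gives `1 - ‖v‖² = (1 - |w|²)‖φ‖²` for unit `u`. If no unit vector had `‖v‖ < 1`, every `φ` would
vanish, hence `B = 0` and `G` would be constant.

Lowering the degree (`exists_extraction`): polarizing the energy identity against `φ` gives `[u; v]*
J [I; G] = (z - w) φ* s`. The zero at `w` cancels the pole of the inverse elementary factor.
Removing the factor costs in the `J`-form exactly the energy of the component of the state along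
`φ`, so energy is still conserved with the state compressed to the orthogonal complement of `φ`, of
dimension one less. Conversely, applying an elementary factor adds at most one state
(`hasRealization_of_lft`), so the degree drops by exactly one.

Linear fractional maps act on graphs `[I; G]` by matrix multiplication up to a right unit
(`lft_eq_iff`). This gives injectivity and turns the iterated transformation into that of the
product. In degree zero the isometric realization is a constant unitary matrix. -/

namespace TangentialSchur

open Polynomial

/-! ### Values of rational functions at finite points -/

/-- `f` is analytic at `z` with value `c`. -/
def HasVal (f : RatFunc ℂ) (z c : ℂ) : Prop :=
  ∃ P Q : ℂ[X], Q.eval z ≠ 0 ∧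
    f * algebraMap ℂ[X] (RatFunc ℂ) Q = algebraMap ℂ[X] (RatFunc ℂ) P ∧ P.eval z = c * Q.eval z

namespace HasVal

variable {f g : RatFunc ℂ} {z c d : ℂ}

theorem add (hf : HasVal f z c) (hg : HasVal g z d) : HasVal (f + g) z (c + d) := by
  obtain ⟨P, Q, hQ, h, hv⟩ := hf
  obtain ⟨P', Q', hQ', h', hv'⟩ := hg
  refine ⟨P * Q' + P' * Q, Q * Q', by simp [hQ, hQ'], ?_, ?_⟩
  · simp only [map_add, map_mul, ← h, ← h']; ring
  · simp only [eval_add, eval_mul, hv, hv']; ring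

theorem mul (hf : HasVal f z c) (hg : HasVal g z d) : HasVal (f * g) z (c * d) := by
  obtain ⟨P, Q, hQ, h, hv⟩ := hf
  obtain ⟨P', Q', hQ', h', hv'⟩ := hg
  refine ⟨P * P', Q * Q', by simp [hQ, hQ'], ?_, ?_⟩
  · simp only [map_mul, ← h, ← h']; ring
  · simp only [eval_mul, hv, hv']; ring

theorem ofC (z c : ℂ) : HasVal (RatFunc.C c) z c :=
  ⟨Polynomial.C c, 1, by simp, by simp, by simp⟩

theorem ofX (z : ℂ) : HasVal RatFunc.X z z :=
  ⟨Polynomial.X, 1, by simp, by simp, by simp⟩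

theorem zero (z : ℂ) : HasVal 0 z 0 := by simpa using ofC z 0

theorem one (z : ℂ) : HasVal 1 z 1 := by simpa using ofC z 1

theorem neg (hf : HasVal f z c) : HasVal (-f) z (-c) := by
  obtain ⟨P, Q, hQ, h, hv⟩ := hf
  exact ⟨-P, Q, hQ, by simp [← h], by simp [hv]⟩

theorem sub (hf : HasVal f z c) (hg : HasVal g z d) : HasVal (f - g) z (c - d) := by
  simpa only [sub_eq_add_neg] using hf.add hg.neg

theorem inv (hf : HasVal f z c) (hc : c ≠ 0) : HasVal f⁻¹ z c⁻¹ := by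
  obtain ⟨P, Q, hQ, h, hv⟩ := hf
  have hP : P.eval z ≠ 0 := by rw [hv]; exact mul_ne_zero hc hQ
  have hP0 : algebraMap ℂ[X] (RatFunc ℂ) P ≠ 0 := by
    rw [map_ne_zero_iff _ (RatFunc.algebraMap_injective ℂ)]
    rintro rfl
    simp at hP
  have hf0 : f ≠ 0 := by
    rintro rfl
    exact hP0 (by simpa using h.symm)
  refine ⟨Q, P, hP, ?_, ?_⟩
  · rw [← h]; field_simp
  · rw [hv]; field_simp

theorem sum {ι : Type*} (s : Finset ι) {f : ι → RatFunc ℂ} {c : ι → ℂ}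
    (h : ∀ i ∈ s, HasVal (f i) z (c i)) : HasVal (∑ i ∈ s, f i) z (∑ i ∈ s, c i) := by
  classical
  induction s using Finset.induction_on with
  | empty => simpa using zero z
  | insert a s ha ih =>
    rw [Finset.sum_insert ha, Finset.sum_insert ha]
    exact (h a (by simp)).add (ih fun i hi => h i (by simp [hi]))

theorem prod {ι : Type*} (s : Finset ι) {f : ι → RatFunc ℂ} {c : ι → ℂ}
    (h : ∀ i ∈ s, HasVal (f i) z (c i)) : HasVal (∏ i ∈ s, f i) z (∏ i ∈ s, c i) := by
  classical
  induction s using Finset.induction_on with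
  | empty => simpa using one z
  | insert a s ha ih =>
    rw [Finset.prod_insert ha, Finset.prod_insert ha]
    exact (h a (by simp)).mul (ih fun i hi => h i (by simp [hi]))

theorem unique (hf : HasVal f z c) (hg : HasVal f z d) : c = d := by
  obtain ⟨P, Q, hQ, h, hv⟩ := hf
  obtain ⟨P', Q', hQ', h', hv'⟩ := hg
  have : P * Q' = P' * Q := by
    apply RatFunc.algebraMap_injective
    simp only [map_mul, ← h, ← h']; ring
  have := congrArg (Polynomial.eval z) this
  simp only [eval_mul, hv, hv'] at this
  have h2 : (c - d) * (Q.eval z * Q'.eval z) = 0 := by linear_combination this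
  rcases mul_eq_zero.1 h2 with h3 | h3
  · exact sub_eq_zero.1 h3
  · exact absurd h3 (mul_ne_zero hQ hQ')

theorem _root_.TangentialSchur.mul_denom_eq (f : RatFunc ℂ) :
    f * algebraMap ℂ[X] (RatFunc ℂ) f.denom = algebraMap ℂ[X] (RatFunc ℂ) f.num := by
  have : algebraMap ℂ[X] (RatFunc ℂ) f.denom ≠ 0 :=
    (map_ne_zero_iff _ (RatFunc.algebraMap_injective ℂ)).2 f.denom_ne_zero
  rw [← eq_div_iff this, RatFunc.num_div_denom]

/-- If the reduced denominator vanished at `z`, cross-multiplication would make the reduced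
numerator vanish there too, against coprimality. Hence any fraction with nonvanishing denominator
may be used to compute values. -/
theorem analyticAtPt (hf : HasVal f z c) : AnalyticAtPt f (z : OnePoint ℂ) := by
  obtain ⟨P, Q, hQ, h, hv⟩ := hf
  change f.denom.eval z ≠ 0
  intro h0
  have hPQ : f.num * Q = P * f.denom := by
    apply RatFunc.algebraMap_injective
    simp only [map_mul, ← h, ← mul_denom_eq]; ring
  have h1 := congrArg (Polynomial.eval z) hPQ
  simp only [eval_mul, h0, mul_zero] at h1
  have h2 : f.num.eval z = 0 := (mul_eq_zero.1 h1).resolve_right hQ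
  obtain ⟨a, b, hab⟩ := f.isCoprime_num_denom
  have := congrArg (Polynomial.eval z) hab
  simp [h0, h2] at this

theorem of_analyticAtPt (h : AnalyticAtPt f (z : OnePoint ℂ)) : HasVal f z (valueAt f z) := by
  change f.denom.eval z ≠ 0 at h
  refine ⟨f.num, f.denom, h, mul_denom_eq f, ?_⟩
  change _ = f.num.eval z / f.denom.eval z * _
  field_simp

theorem valueAt_eq (hf : HasVal f z c) : valueAt f (z : OnePoint ℂ) = c :=
  (of_analyticAtPt hf.analyticAtPt).unique hf

theorem eventually (f : RatFunc ℂ) : ∀ᶠ z : ℂ in Filter.cofinite, AnalyticAtPt f (z : OnePoint ℂ) := by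
  have : {z : ℂ | f.denom.eval z = 0}.Finite := by
    refine (f.denom.roots.toFinset.finite_toSet).subset fun z hz => ?_
    simpa [f.denom_ne_zero] using hz
  refine this.subset fun z hz => ?_
  simpa [AnalyticAtPt] using hz

end HasVal

/-- A rational function is zero if it vanishes at infinitely many points. -/
theorem ratFunc_eq_zero_of_infinite {f : RatFunc ℂ} {S : Set ℂ} (hS : S.Infinite)
    (h : ∀ z ∈ S, HasVal f z 0) : f = 0 := by
  have h0 : f.num = 0 := by
    refine Polynomial.eq_zero_of_infinite_isRoot _ (hS.mono fun z hz => ?_)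
    have h1 := (h z hz).analyticAtPt
    have h2 := (h z hz).valueAt_eq
    change f.denom.eval z ≠ 0 at h1
    change f.num.eval z / f.denom.eval z = 0 at h2
    simpa [h1] using h2
  simpa using h0

/-! ### Values of rational matrices -/

/-- `G` is analytic at `z` with value `M`. -/
def MatHasVal {m n : Type} (G : RatMat m n) (z : ℂ) (M : Matrix m n ℂ) : Prop :=
  ∀ i j, HasVal (G i j) z (M i j)

namespace MatHasVal

variable {l m n : Type} {z : ℂ}

theorem const (M : Matrix m n ℂ) (z : ℂ) : MatHasVal (const M) z M := fun _ _ => HasVal.ofC _ _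

theorem add {G G' : RatMat m n} {M M' : Matrix m n ℂ} (h : MatHasVal G z M)
    (h' : MatHasVal G' z M') : MatHasVal (G + G') z (M + M') := fun i j => (h i j).add (h' i j)

theorem sub {G G' : RatMat m n} {M M' : Matrix m n ℂ} (h : MatHasVal G z M)
    (h' : MatHasVal G' z M') : MatHasVal (G - G') z (M - M') := fun i j => (h i j).sub (h' i j)

theorem smul {f : RatFunc ℂ} {c : ℂ} {G : RatMat m n} {M : Matrix m n ℂ} (hf : HasVal f z c)
    (h : MatHasVal G z M) : MatHasVal (f • G) z (c • M) := fun i j => hf.mul (h i j)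

theorem mul [Fintype m] {G : RatMat l m} {G' : RatMat m n} {M : Matrix l m ℂ} {M' : Matrix m n ℂ}
    (h : MatHasVal G z M) (h' : MatHasVal G' z M') : MatHasVal (G * G') z (M * M') :=
  fun i j => HasVal.sum _ fun k _ => (h i k).mul (h' k j)

theorem one [DecidableEq m] : MatHasVal (1 : RatMat m m) z 1 := fun i j => by
  by_cases h : i = j
  · subst h; simpa using HasVal.one z
  · simpa [h] using HasVal.zero z

theorem det [Fintype m] [DecidableEq m] {G : RatMat m m} {M : Matrix m m ℂ}
    (h : MatHasVal G z M) : HasVal G.det z M.det := by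
  rw [Matrix.det_apply', Matrix.det_apply']
  refine HasVal.sum _ fun σ _ => HasVal.mul ?_ (HasVal.prod _ fun i _ => h _ _)
  simpa using HasVal.ofC z ((Equiv.Perm.sign σ : ℤ) : ℂ)

theorem inv [Fintype m] [DecidableEq m] {G : RatMat m m} {M : Matrix m m ℂ}
    (h : MatHasVal G z M) (hM : M.det ≠ 0) : MatHasVal G⁻¹ z M⁻¹ := by
  have hG : G.det ≠ 0 := by
    intro h0
    have := h.det
    rw [h0] at this
    exact hM (this.unique (HasVal.zero z))
  rw [Matrix.inv_def, Matrix.inv_def, Ring.inverse_eq_inv', Ring.inverse_eq_inv']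
  refine smul (h.det.inv hM) fun i j => ?_
  rw [Matrix.adjugate_apply, Matrix.adjugate_apply]
  refine det fun k l => ?_
  rw [Matrix.updateRow_apply, Matrix.updateRow_apply]
  split_ifs with hk
  · by_cases hl : l = i
    · subst hl; simpa using HasVal.one z
    · simpa [hl] using HasVal.zero z
  · exact h _ _

theorem isUnit [Fintype m] [DecidableEq m] {G : RatMat m m} {M : Matrix m m ℂ}
    (h : MatHasVal G z M) (hM : M.det ≠ 0) : IsUnit G := by
  rw [Matrix.isUnit_iff_isUnit_det, isUnit_iff_ne_zero]
  intro h0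
  have := h.det
  rw [h0] at this
  exact hM (this.unique (HasVal.zero z))

theorem unique {G : RatMat m n} {M M' : Matrix m n ℂ} (h : MatHasVal G z M)
    (h' : MatHasVal G z M') : M = M' := by
  ext i j; exact (h i j).unique (h' i j)

theorem matAnalyticAt {G : RatMat m n} {M : Matrix m n ℂ} (h : MatHasVal G z M) :
    MatAnalyticAt G (z : OnePoint ℂ) := fun i j => (h i j).analyticAtPt

theorem matValueAt_eq {G : RatMat m n} {M : Matrix m n ℂ} (h : MatHasVal G z M) :
    matValueAt G (z : OnePoint ℂ) = M := by
  ext i j; exact (h i j).valueAt_eq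

theorem eventually [Finite m] [Finite n] (G : RatMat m n) :
    ∀ᶠ z : ℂ in Filter.cofinite, MatAnalyticAt G (z : OnePoint ℂ) := by
  simp only [MatAnalyticAt, Filter.eventually_all]
  exact fun i j => HasVal.eventually _

end MatHasVal

/-! ### Behaviour at infinity -/

open Classical in
/-- `f` vanishes at infinity. -/
def StrictlyProper (f : RatFunc ℂ) : Prop := RatFunc.inftyValuation ℂ f < 1

namespace StrictlyProper

variable {f g : RatFunc ℂ}

theorem sum {ι : Type*} (s : Finset ι) {f : ι → RatFunc ℂ}
    (h : ∀ i ∈ s, StrictlyProper (f i)) : StrictlyProper (∑ i ∈ s, f i) :=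
  Valuation.map_sum_lt _ one_ne_zero h

open Classical in
theorem valuation_C_le (c : ℂ) : RatFunc.inftyValuation ℂ (RatFunc.C c) ≤ 1 := by
  by_cases hc : c = 0
  · simp [hc]
  · rw [RatFunc.inftyValuation.C _ hc]

theorem C_mul (c : ℂ) (hf : StrictlyProper f) : StrictlyProper (RatFunc.C c * f) := by
  classical
  unfold StrictlyProper at *
  rw [map_mul]
  exact (mul_le_mul_left (valuation_C_le c) _).trans_lt (by simpa using hf)

theorem mul_C (c : ℂ) (hf : StrictlyProper f) : StrictlyProper (f * RatFunc.C c) := by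
  rw [mul_comm]; exact hf.C_mul c

theorem natDegree_lt (hf : StrictlyProper f) : f = 0 ∨ f.num.natDegree < f.denom.natDegree := by
  classical
  by_cases h0 : f = 0
  · exact Or.inl h0
  · right
    unfold StrictlyProper at hf
    rw [RatFunc.inftyValuation_apply, RatFunc.inftyValuation_of_nonzero _ h0] at hf
    rw [← WithZero.exp_zero, WithZero.exp_lt_exp, RatFunc.intDegree] at hf
    omega

/-- A strictly proper rational function without poles vanishes. -/
theorem eq_zero (hf : StrictlyProper f) (h : ∀ z : ℂ, AnalyticAtPt f (z : OnePoint ℂ)) : f = 0 := by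
  rcases hf.natDegree_lt with h0 | h0
  · exact h0
  · exfalso
    obtain ⟨z, hz⟩ := Complex.exists_root (f := f.denom)
      (Polynomial.natDegree_pos_iff_degree_pos.1 (by omega))
    exact h z hz

end StrictlyProper

theorem strictlyProper_C_iff {c : ℂ} : StrictlyProper (RatFunc.C c) ↔ c = 0 := by
  classical
  unfold StrictlyProper
  by_cases hc : c = 0
  · simp [hc]
  · rw [RatFunc.inftyValuation.C _ hc]; simp [hc]

/-- The fraction `(c * g.denom + g.num) / g.denom` also represents `f`. Comparing degrees and top
coefficients in the cross-multiplied polynomial identity avoids reducing it. -/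
theorem value_infty_of_strictlyProper {f g : RatFunc ℂ} {c : ℂ} (h : f = RatFunc.C c + g)
    (hg : StrictlyProper g) :
    AnalyticAtPt f OnePoint.infty ∧ valueAt f OnePoint.infty = c := by
  change f.num.natDegree ≤ f.denom.natDegree ∧
    f.num.coeff f.denom.natDegree / f.denom.leadingCoeff = c
  have hfd := f.denom_ne_zero
  have hgd := g.denom_ne_zero
  set q := Polynomial.C c * g.denom + g.num with hq
  have hle : q.natDegree ≤ g.denom.natDegree ∧ q.coeff g.denom.natDegree =
      c * g.denom.leadingCoeff := by
    have h1 : g.num.natDegree ≤ g.denom.natDegree ∧ g.num.coeff g.denom.natDegree = 0 := by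
      rcases hg.natDegree_lt with h0 | h0
      · simp [h0]
      · exact ⟨h0.le, Polynomial.coeff_eq_zero_of_natDegree_lt h0⟩
    refine ⟨(Polynomial.natDegree_add_le _ _).trans (max_le ?_ h1.1), ?_⟩
    · exact Polynomial.natDegree_C_mul_le _ _
    · simp [hq, h1.2]
  have hc : f.num * g.denom = f.denom * q := by
    apply RatFunc.algebraMap_injective
    have e1 := mul_denom_eq f
    have e2 := mul_denom_eq g
    simp only [hq, map_mul, map_add, ← e1, ← e2, RatFunc.algebraMap_C]
    rw [h]; ring
  have hdeg : f.num.natDegree ≤ f.denom.natDegree := by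
    by_cases hf0 : f.num = 0
    · simp [hf0]
    · have e := congrArg Polynomial.natDegree hc
      rw [Polynomial.natDegree_mul hf0 hgd] at e
      have := Polynomial.natDegree_mul_le (p := f.denom) (q := q)
      omega
  refine ⟨hdeg, ?_⟩
  have e := congrArg (fun r => r.coeff (f.denom.natDegree + g.denom.natDegree)) hc
  rw [Polynomial.coeff_mul_add_eq_of_natDegree_le hdeg le_rfl,
    Polynomial.coeff_mul_add_eq_of_natDegree_le le_rfl hle.1, hle.2] at e
  have l1 : f.denom.leadingCoeff ≠ 0 := by simpa using hfd
  have l2 : g.denom.leadingCoeff ≠ 0 := by simpa using hgd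
  rw [div_eq_iff l1]
  apply mul_right_cancel₀ l2
  change _ * g.denom.coeff _ = _
  rw [e]; simp only [Polynomial.coeff_natDegree]; ring

end TangentialSchur

namespace TangentialSchur

open Matrix

/-! ### Constant matrices -/

section Const
variable {l m n : Type}

theorem const_mul [Fintype m] (M : Matrix l m ℂ) (N : Matrix m n ℂ) :
    const (M * N) = const M * const N := by
  simp only [const, Matrix.map_mul]

theorem const_add (M N : Matrix m n ℂ) : const (M + N) = const M + const N :=
  Matrix.map_add _ (fun _ _ => map_add _ _ _) M N

theorem const_sub (M N : Matrix m n ℂ) : const (M - N) = const M - const N :=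
  Matrix.map_sub _ (fun _ _ => map_sub _ _ _) M N

theorem const_smul (c : ℂ) (M : Matrix m n ℂ) : const (c • M) = RatFunc.C c • const M := by
  ext i j; simp [const]

theorem const_one [DecidableEq m] : const (1 : Matrix m m ℂ) = 1 :=
  Matrix.map_one _ (map_zero _) (map_one _)

theorem const_zero : const (0 : Matrix m n ℂ) = 0 := Matrix.map_zero _ (map_zero _)

theorem const_fromRows {k : Type} (M : Matrix l n ℂ) (N : Matrix k n ℂ) :
    const (fromRows M N) = fromRows (const M) (const N) := by
  ext (i | i) j <;> rfl

theorem const_fromCols {k : Type} (M : Matrix l n ℂ) (N : Matrix l k ℂ) :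
    const (fromCols M N) = fromCols (const M) (const N) := by
  ext i (j | j) <;> rfl

end Const

/-! ### State-space realizations -/

/-- The pencil `z I - A`. -/
noncomputable def pencil {σ : Type} [DecidableEq σ] (A : Matrix σ σ ℂ) : RatMat σ σ :=
  (RatFunc.X : RatFunc ℂ) • (1 : RatMat σ σ) - const A

section Pencil
variable {σ : Type} [Fintype σ] [DecidableEq σ]

theorem matHasVal_pencil (A : Matrix σ σ ℂ) (z : ℂ) : MatHasVal (pencil A) z (z • 1 - A) :=
  (MatHasVal.one.smul (HasVal.ofX z)).sub (MatHasVal.const A z)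

theorem det_smul_one_sub (A : Matrix σ σ ℂ) (z : ℂ) : (z • 1 - A).det = A.charpoly.eval z := by
  rw [Matrix.eval_charpoly, Matrix.scalar_apply, Matrix.smul_one_eq_diagonal]

theorem eventually_det_ne_zero (A : Matrix σ σ ℂ) :
    ∀ᶠ z : ℂ in Filter.cofinite, (z • 1 - A).det ≠ 0 := by
  refine (A.charpoly.roots.toFinset.finite_toSet).subset fun z hz => ?_
  simpa [det_smul_one_sub, A.charpoly_monic.ne_zero] using hz

theorem isUnit_pencil (A : Matrix σ σ ℂ) : IsUnit (pencil A) := by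
  obtain ⟨z, hz⟩ := (eventually_det_ne_zero A).exists
  exact (matHasVal_pencil A z).isUnit hz

theorem pencil_mul_inv (A : Matrix σ σ ℂ) : pencil A * (pencil A)⁻¹ = 1 :=
  Matrix.mul_nonsing_inv _ ((Matrix.isUnit_iff_isUnit_det _).1 (isUnit_pencil A))

theorem inv_mul_pencil (A : Matrix σ σ ℂ) : (pencil A)⁻¹ * pencil A = 1 :=
  Matrix.nonsing_inv_mul _ ((Matrix.isUnit_iff_isUnit_det _).1 (isUnit_pencil A))

/-- The state equation `z s = A s + B c` in resolvent form. It drives the degree estimate at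
infinity and the shift hypothesis of the lurking isometry. -/
theorem X_smul_pencil_inv (A : Matrix σ σ ℂ) :
    (RatFunc.X : RatFunc ℂ) • (pencil A)⁻¹ = 1 + const A * (pencil A)⁻¹ := by
  have h := pencil_mul_inv A
  rw [pencil, Matrix.sub_mul, Matrix.smul_mul, Matrix.one_mul, ← pencil] at h
  rw [← h]; abel

theorem X_smul_pencil_inv' (A : Matrix σ σ ℂ) :
    (RatFunc.X : RatFunc ℂ) • (pencil A)⁻¹ = 1 + (pencil A)⁻¹ * const A := by
  have h := inv_mul_pencil A
  rw [pencil, Matrix.mul_sub, Matrix.mul_smul, Matrix.mul_one, ← pencil] at h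
  rw [← h]; abel

end Pencil

/-- `G(z) = D + C (z I - A)⁻¹ B`. -/
def Realizes {σ p q : Type} [Fintype σ] [DecidableEq σ] (G : RatMat p q) (A : Matrix σ σ ℂ)
    (B : Matrix σ q ℂ) (C : Matrix p σ ℂ) (D : Matrix p q ℂ) : Prop :=
  G = const D + const C * (pencil A)⁻¹ * const B

theorem Realizes.matHasVal {σ p q : Type} [Fintype σ] [DecidableEq σ] {G : RatMat p q}
    {A : Matrix σ σ ℂ} {B : Matrix σ q ℂ} {C : Matrix p σ ℂ} {D : Matrix p q ℂ}
    (h : Realizes G A B C D) {z : ℂ} (hz : (z • 1 - A).det ≠ 0) :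
    MatHasVal G z (D + C * (z • 1 - A)⁻¹ * B) := by
  rw [h]
  exact (MatHasVal.const _ _).add
    (((MatHasVal.const _ _).mul ((matHasVal_pencil A z).inv hz)).mul (MatHasVal.const _ _))

theorem hasRealization_iff {p q : ℕ} {G : RatMat (Fin p) (Fin q)} {n : ℕ} :
    HasRealization G n ↔ ∃ (A : Matrix (Fin n) (Fin n) ℂ) (B : Matrix (Fin n) (Fin q) ℂ)
      (C : Matrix (Fin p) (Fin n) ℂ) (D : Matrix (Fin p) (Fin q) ℂ), Realizes G A B C D := Iff.rfl

/-- A matrix intertwining two pencils transports realizations. -/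
theorem Realizes.of_intertwine {σ τ p q : Type} [Fintype σ] [DecidableEq σ] [Fintype τ]
    [DecidableEq τ] {G : RatMat p q}
    {A : Matrix σ σ ℂ} {B : Matrix σ q ℂ} {C : Matrix p σ ℂ} {D : Matrix p q ℂ}
    (h : Realizes G A B C D) {A' : Matrix τ τ ℂ} {B' : Matrix τ q ℂ} (K : Matrix σ τ ℂ)
    (hA : A * K = K * A') (hB : B = K * B') : Realizes G A' B' (C * K) D := by
  have e : (pencil A)⁻¹ * const K = const K * (pencil A')⁻¹ := by
    have e1 : pencil A * const K = const K * pencil A' := by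
      simp only [pencil, Matrix.sub_mul, Matrix.mul_sub, ← const_mul, hA]
      simp
    calc (pencil A)⁻¹ * const K = (pencil A)⁻¹ * (const K * pencil A') * (pencil A')⁻¹ := by
          rw [Matrix.mul_assoc, Matrix.mul_assoc, pencil_mul_inv, Matrix.mul_one]
      _ = _ := by rw [← e1, ← Matrix.mul_assoc, inv_mul_pencil, Matrix.one_mul]
  rw [Realizes, h, hB, const_mul, const_mul]
  congr 1
  simp only [Matrix.mul_assoc]
  congr 1
  rw [← Matrix.mul_assoc, e, Matrix.mul_assoc]

theorem Realizes.hasRealization {σ : Type} [Fintype σ] [DecidableEq σ] {p q : ℕ}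
    {G : RatMat (Fin p) (Fin q)} {A : Matrix σ σ ℂ} {B : Matrix σ (Fin q) ℂ}
    {C : Matrix (Fin p) σ ℂ} {D : Matrix (Fin p) (Fin q) ℂ} (h : Realizes G A B C D) :
    HasRealization G (Fintype.card σ) := by
  let e := Fintype.equivFin σ
  refine ⟨A.submatrix e.symm e.symm, B.submatrix e.symm id, _, D,
    h.of_intertwine ((1 : Matrix σ σ ℂ).submatrix id e.symm) ?_ ?_⟩
  · rw [Matrix.submatrix_mul_equiv]
    ext i j
    simp [Matrix.mul_apply, Matrix.one_apply]
  · rw [Matrix.submatrix_mul_equiv]; simp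

/-! ### Isometric realizations and the lurking isometry. -/

/-- `G` has a realization whose realization matrix is isometric, with states indexed by `σ`. -/
def IsometricRealization {p : Type} [Fintype p] [DecidableEq p] (σ : Type) [Fintype σ]
    [DecidableEq σ] (G : RatMat p p) : Prop :=
  ∃ (A : Matrix σ σ ℂ) (B : Matrix σ p ℂ) (C : Matrix p σ ℂ) (D : Matrix p p ℂ),
    (fromBlocks A B C D)ᴴ * fromBlocks A B C D = 1 ∧ Realizes G A B C D

theorem star_dotProduct_mulVec_of_isometry {k : Type} [Fintype k] [DecidableEq k]
    {R : Matrix k k ℂ} (hR : Rᴴ * R = 1) (x y : k → ℂ) :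
    star (R *ᵥ x) ⬝ᵥ (R *ᵥ y) = star x ⬝ᵥ y := by
  rw [Matrix.star_mulVec, ← Matrix.dotProduct_mulVec, Matrix.mulVec_mulVec, hR, Matrix.one_mulVec]

theorem isometry_of_star_dotProduct {k : Type} [Fintype k] [DecidableEq k] {R : Matrix k k ℂ}
    (h : ∀ x y, star (R *ᵥ x) ⬝ᵥ (R *ᵥ y) = star x ⬝ᵥ y) : Rᴴ * R = 1 := by
  ext i j
  have := h (Pi.single i 1) (Pi.single j 1)
  rw [Matrix.star_mulVec, ← Matrix.dotProduct_mulVec, Matrix.mulVec_mulVec] at this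
  simpa [Matrix.one_apply, Pi.single_apply, eq_comm, ← Pi.single_star] using this

theorem norm_toLp_sq {k : Type} [Fintype k] (x : k → ℂ) :
    ((‖WithLp.toLp 2 x‖ : ℂ)) ^ 2 = star x ⬝ᵥ x := by
  rw [← Complex.ofReal_pow, EuclideanSpace.norm_sq_eq]
  simp [dotProduct, Complex.conj_mul']

/-- Two matrices with the same number of rows and the same Gram matrix differ by an isometry. -/
theorem exists_isometry_mul_eq {k m : Type} [Fintype k] [DecidableEq k] [Fintype m]
    [DecidableEq m] (Y Z : Matrix k m ℂ)
    (h : ∀ v, star (Y *ᵥ v) ⬝ᵥ (Y *ᵥ v) = star (Z *ᵥ v) ⬝ᵥ (Z *ᵥ v)) :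
    ∃ R : Matrix k k ℂ, Rᴴ * R = 1 ∧ R * Y = Z := by
  let T : Matrix k m ℂ → (EuclideanSpace ℂ m →ₗ[ℂ] EuclideanSpace ℂ k) := Matrix.toEuclideanLin
  have hT : ∀ (M : Matrix k m ℂ) (v : EuclideanSpace ℂ m),
      T M v = WithLp.toLp 2 (M *ᵥ WithLp.ofLp v) := fun _ _ => rfl
  have hn : ∀ v, ‖T Y v‖ = ‖T Z v‖ := by
    intro v
    have := h (WithLp.ofLp v)
    rw [← norm_toLp_sq, ← norm_toLp_sq] at this
    have h2 : ‖T Y v‖ ^ 2 = ‖T Z v‖ ^ 2 := by exact_mod_cast this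
    exact (sq_eq_sq₀ (norm_nonneg _) (norm_nonneg _)).1 h2
  -- Equality of norms makes `T Y v ↦ T Z v` well defined on the range of `T Y`. The linear
  -- extension `g` is arbitrary off that range and is used only there.
  have hker : LinearMap.ker (T Y) ≤ LinearMap.ker (T Z) := by
    intro v hv
    rw [LinearMap.mem_ker] at hv ⊢
    rw [← norm_eq_zero, ← hn, hv, norm_zero]
  obtain ⟨g, hg⟩ := LinearMap.exists_extend (p := LinearMap.range (T Y))
    (((LinearMap.ker (T Y)).liftQ (T Z) hker).comp (T Y).quotKerEquivRange.symm.toLinearMap)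
  have hgY : ∀ v, g (T Y v) = T Z v := by
    intro v
    have := LinearMap.congr_fun hg ⟨T Y v, v, rfl⟩
    simp only [LinearMap.comp_apply, Submodule.subtype_apply] at this
    rw [this]
    have e : (T Y).quotKerEquivRange.symm ⟨T Y v, v, rfl⟩ = (LinearMap.ker (T Y)).mkQ v :=
      (T Y).quotKerEquivRange_symm_apply_image v _
    simp only [LinearEquiv.coe_coe]
    rw [e]; simp
  -- An isometry from a subspace into the same finite-dimensional space extends to the whole space,
  -- since the orthogonal complements of its domain and image have equal dimension.
  let f : LinearMap.range (T Y) →ₗᵢ[ℂ] EuclideanSpace ℂ k :=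
    { toLinearMap := g.comp (Submodule.subtype _)
      norm_map' := by
        rintro ⟨_, v, rfl⟩
        simp only [LinearMap.comp_apply, Submodule.subtype_apply, hgY, ← hn]
        rfl }
  have hfY : ∀ v, f.extend (T Y v) = T Z v := by
    intro v
    rw [← hgY]
    exact f.extend_apply ⟨T Y v, v, rfl⟩
  set R : Matrix k k ℂ := Matrix.toEuclideanLin.symm f.extend.toLinearMap with hR
  have h1 : ∀ x, R *ᵥ x = WithLp.ofLp (f.extend (WithLp.toLp 2 x)) := by
    intro x
    have : Matrix.toEuclideanLin R (WithLp.toLp 2 x) = f.extend (WithLp.toLp 2 x) := by simp [hR]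
    rw [← this]; rfl
  refine ⟨R, ?_, ?_⟩
  · apply isometry_of_star_dotProduct
    intro x y
    rw [h1, h1, dotProduct_comm, dotProduct_comm (star x)]
    exact f.extend.inner_map_map (WithLp.toLp 2 x) (WithLp.toLp 2 y)
  · apply Matrix.toEuclideanLin.injective
    ext1 v
    change WithLp.toLp 2 ((R * Y) *ᵥ WithLp.ofLp v) = T Z v
    rw [← hfY, ← Matrix.mulVec_mulVec, h1]
    rfl

/-- Lurking isometry: a rational matrix function described by an energy-preserving linear
relation has an isometric realization. -/
theorem isometricRealization_of_energy {σ p m : Type} [Fintype σ] [DecidableEq σ] [Fintype p]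
    [DecidableEq p] [Fintype m] [DecidableEq m] (Yx Zx : Matrix σ m ℂ) (Ya Zy : Matrix p m ℂ)
    (h : ∀ v, star (Yx *ᵥ v) ⬝ᵥ (Yx *ᵥ v) + star (Ya *ᵥ v) ⬝ᵥ (Ya *ᵥ v) =
      star (Zx *ᵥ v) ⬝ᵥ (Zx *ᵥ v) + star (Zy *ᵥ v) ⬝ᵥ (Zy *ᵥ v))
    (Φ : RatMat m p) (hX : (RatFunc.X : RatFunc ℂ) • (const Yx * Φ) = const Zx * Φ)
    (hM : IsUnit (const Ya * Φ)) :
    IsometricRealization σ (const Zy * Φ * (const Ya * Φ)⁻¹) := by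
  obtain ⟨R, hR, hRY⟩ := exists_isometry_mul_eq (fromRows Yx Ya) (fromRows Zx Zy) (by
    intro v
    have e : ∀ (M : Matrix σ m ℂ) (N : Matrix p m ℂ),
        star (fromRows M N *ᵥ v) ⬝ᵥ (fromRows M N *ᵥ v) =
        star (M *ᵥ v) ⬝ᵥ (M *ᵥ v) + star (N *ᵥ v) ⬝ᵥ (N *ᵥ v) := by
      intro M N
      simp [fromRows_mulVec, dotProduct, Fintype.sum_sum_type]
    rw [e, e, h])
  obtain ⟨A, B, C, D, rfl⟩ : ∃ A B C D, R = fromBlocks A B C D :=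
    ⟨_, _, _, _, (fromBlocks_toBlocks R).symm⟩
  refine ⟨A, B, C, D, hR, ?_⟩
  rw [fromBlocks_mul_fromRows] at hRY
  obtain ⟨h1, h2⟩ := fromRows_ext_iff _ _ _ _ |>.1 hRY
  set M := const Ya * Φ with hMdef
  have hMM : M * M⁻¹ = 1 := Matrix.mul_nonsing_inv _ ((Matrix.isUnit_iff_isUnit_det _).1 hM)
  -- Along `Φ` the updated state `Zx Φ` is both `z Yx Φ`, by `hX`, and `A Yx Φ + B Ya Φ`, by the
  -- isometry. So `Yx Φ` is the state driven by the input `M`.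
  have e1 : pencil A * (const Yx * Φ) = const B * M := by
    rw [pencil, Matrix.sub_mul, Matrix.smul_mul, Matrix.one_mul, hX, ← h1, const_add, const_mul,
      const_mul, Matrix.add_mul, hMdef]
    simp only [Matrix.mul_assoc]
    abel
  have e2 : const Yx * Φ = (pencil A)⁻¹ * const B * M := by
    rw [Matrix.mul_assoc, ← e1, ← Matrix.mul_assoc, inv_mul_pencil, Matrix.one_mul]
  rw [Realizes, ← h2, const_add, const_mul, const_mul, Matrix.add_mul, Matrix.mul_assoc, e2,
    Matrix.mul_assoc (const D), ← hMdef, Matrix.add_mul, Matrix.mul_assoc (const D), hMM,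
    Matrix.mul_one, add_comm]
  simp only [Matrix.mul_assoc, hMM, Matrix.mul_one]

/-! ### Energy of a vector -/

/-- The squared Euclidean norm. -/
noncomputable def energy {k : Type} [Fintype k] (x : k → ℂ) : ℝ := ∑ i, ‖x i‖ ^ 2

section Energy
variable {k l : Type} [Fintype k] [Fintype l]

theorem star_dotProduct_self (x : k → ℂ) : star x ⬝ᵥ x = (energy x : ℂ) := by
  simp [energy, dotProduct, Complex.conj_mul']

theorem energy_nonneg (x : k → ℂ) : 0 ≤ energy x := Finset.sum_nonneg fun _ _ => by positivity

theorem energy_eq_zero {x : k → ℂ} : energy x = 0 ↔ x = 0 := by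
  rw [energy, Finset.sum_eq_zero_iff_of_nonneg fun _ _ => by positivity]
  simp [funext_iff]

theorem energy_smul (c : ℂ) (x : k → ℂ) : energy (c • x) = ‖c‖ ^ 2 * energy x := by
  simp [energy, Finset.mul_sum, mul_pow]

theorem energy_ofLp (x : EuclideanSpace ℂ k) : energy (WithLp.ofLp x) = ‖x‖ ^ 2 := by
  rw [EuclideanSpace.norm_sq_eq]; rfl

theorem energy_mulVec_of_isometry [DecidableEq k] {R : Matrix k k ℂ} (hR : Rᴴ * R = 1)
    (x : k → ℂ) : energy (R *ᵥ x) = energy x := by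
  have := star_dotProduct_mulVec_of_isometry hR x x
  rw [star_dotProduct_self, star_dotProduct_self] at this
  exact_mod_cast this

theorem posSemidef_gram_sub_one_iff [DecidableEq k] {M : Matrix k k ℂ} :
    (Mᴴ * M - 1).PosSemidef ↔ ∀ x, energy x ≤ energy (M *ᵥ x) := by
  have e : ∀ x, star x ⬝ᵥ ((Mᴴ * M - 1) *ᵥ x) = ((energy (M *ᵥ x) - energy x : ℝ) : ℂ) := by
    intro x
    rw [Matrix.sub_mulVec, dotProduct_sub, Matrix.one_mulVec, ← Matrix.mulVec_mulVec,
      Matrix.dotProduct_mulVec _ Mᴴ, ← Matrix.star_mulVec, star_dotProduct_self, star_dotProduct_self]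
    push_cast; rfl
  constructor
  · intro h x
    have := h.dotProduct_mulVec_nonneg x
    rw [e] at this
    have := Complex.zero_le_real.1 this
    linarith
  · intro h
    refine .of_dotProduct_mulVec_nonneg ?_ fun x => ?_
    · exact (isHermitian_conjTranspose_mul_self M).sub isHermitian_one
    · rw [e]; exact Complex.zero_le_real.2 (by linarith [h x])

theorem posSemidef_one_sub_gram_iff [DecidableEq k] {M : Matrix k k ℂ} :
    (1 - Mᴴ * M).PosSemidef ↔ ∀ x, energy (M *ᵥ x) ≤ energy x := by
  have e : ∀ x, star x ⬝ᵥ ((1 - Mᴴ * M) *ᵥ x) = ((energy x - energy (M *ᵥ x) : ℝ) : ℂ) := by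
    intro x
    rw [Matrix.sub_mulVec, dotProduct_sub, Matrix.one_mulVec, ← Matrix.mulVec_mulVec,
      Matrix.dotProduct_mulVec _ Mᴴ, ← Matrix.star_mulVec, star_dotProduct_self, star_dotProduct_self]
    push_cast; rfl
  constructor
  · intro h x
    have := h.dotProduct_mulVec_nonneg x
    rw [e] at this
    have := Complex.zero_le_real.1 this
    linarith
  · intro h
    refine .of_dotProduct_mulVec_nonneg ?_ fun x => ?_
    · exact isHermitian_one.sub (isHermitian_conjTranspose_mul_self M)
    · rw [e]; exact Complex.zero_le_real.2 (by linarith [h x])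

end Energy

/-! ### Lossless functions -/

/-- On the circle, equality is the conjunction of the two opposite inequalities. The conditions on
the closed disk and on the closed exterior are then stable under limits. -/
theorem isLossless_iff {p : ℕ} {G : RatMat (Fin p) (Fin p)} :
    IsLossless G ↔ ∀ z : ℂ, MatAnalyticAt G z →
      (‖z‖ ≤ 1 → ∀ x, energy x ≤ energy (matValueAt G z *ᵥ x)) ∧
      (1 ≤ ‖z‖ → ∀ x, energy (matValueAt G z *ᵥ x) ≤ energy x) := by
  have e1 : ∀ M : Matrix (Fin p) (Fin p) ℂ, -1 - Mᴴ * -1 * M = Mᴴ * M - 1 := by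
    intro M; simp [sub_eq_add_neg, add_comm]
  have e2 : ∀ M : Matrix (Fin p) (Fin p) ℂ, Mᴴ * -1 * M - -1 = 1 - Mᴴ * M := by
    intro M; simp [sub_eq_add_neg, add_comm]
  have e3 : ∀ M : Matrix (Fin p) (Fin p) ℂ, Mᴴ * -1 * M = -1 ↔ Mᴴ * M = 1 := by
    intro M; simp
  constructor
  · intro h z hz
    rcases lt_trichotomy ‖z‖ 1 with h1 | h1 | h1
    · refine ⟨fun _ => ?_, fun h2 => by linarith⟩
      rw [← posSemidef_gram_sub_one_iff, ← e1]
      exact h.inside z h1 hz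
    · have := (e3 _).1 (h.circle z h1 hz)
      exact ⟨fun _ x => (energy_mulVec_of_isometry this x).ge,
        fun _ x => (energy_mulVec_of_isometry this x).le⟩
    · refine ⟨fun h2 => by linarith, fun _ => ?_⟩
      rw [← posSemidef_one_sub_gram_iff, ← e2]
      exact h.outside z h1 hz
  · intro h
    refine ⟨fun z h1 hz => ?_, fun z h1 hz => ?_, fun z h1 hz => ?_⟩
    · rw [e1, posSemidef_gram_sub_one_iff]; exact (h z hz).1 h1.le
    · rw [e3]
      have a1 := posSemidef_gram_sub_one_iff.2 ((h z hz).1 h1.le)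
      have a2 := posSemidef_one_sub_gram_iff.2 ((h z hz).2 h1.ge)
      open scoped MatrixOrder in
      exact le_antisymm (Matrix.le_iff.2 a2) (Matrix.le_iff.2 a1)
    · rw [e2, posSemidef_one_sub_gram_iff]; exact (h z hz).2 h1.le

/-! ### Passing to the limit from generic points. -/

theorem mem_closure_of_norm_le {P : ℂ → Prop} (hP : ∀ᶠ z in Filter.cofinite, P z) {z : ℂ}
    (hz : ‖z‖ ≤ 1) : z ∈ closure {x : ℂ | ‖x‖ < 1 ∧ P x} := by
  have hd : Dense {x | P x} := by
    have := Set.Countable.dense_compl ℂ (s := {x | P x}ᶜ) (Set.Finite.countable hP)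
    rwa [compl_compl] at this
  have h1 : Metric.ball (0 : ℂ) 1 ⊆ closure (Metric.ball 0 1 ∩ {x | P x}) :=
    hd.open_subset_closure_inter Metric.isOpen_ball
  have h2 := closure_minimal h1 isClosed_closure
  rw [closure_ball (0 : ℂ) one_ne_zero] at h2
  have := h2 (by simpa using hz : z ∈ Metric.closedBall (0 : ℂ) 1)
  convert this using 2
  ext; simp

theorem mem_closure_of_le_norm {P : ℂ → Prop} (hP : ∀ᶠ z in Filter.cofinite, P z) {z : ℂ}
    (hz : 1 ≤ ‖z‖) : z ∈ closure {x : ℂ | 1 < ‖x‖ ∧ P x} := by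
  have hd : Dense {x | P x} := by
    have := Set.Countable.dense_compl ℂ (s := {x | P x}ᶜ) (Set.Finite.countable hP)
    rwa [compl_compl] at this
  have h1 : (Metric.closedBall (0 : ℂ) 1)ᶜ ⊆ closure ((Metric.closedBall 0 1)ᶜ ∩ {x | P x}) :=
    hd.open_subset_closure_inter Metric.isClosed_closedBall.isOpen_compl
  have h2 := closure_minimal h1 isClosed_closure
  rw [closure_compl, interior_closedBall (0 : ℂ) one_ne_zero] at h2
  have := h2 (by simpa using hz : z ∈ (Metric.ball (0 : ℂ) 1)ᶜ)
  convert this using 2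
  ext; simp

theorem continuousAt_valueAt {f : RatFunc ℂ} {z : ℂ} (h : AnalyticAtPt f (z : OnePoint ℂ)) :
    ContinuousAt (fun x : ℂ => valueAt f (x : OnePoint ℂ)) z :=
  ContinuousAt.div f.num.continuous.continuousAt f.denom.continuous.continuousAt h

theorem continuousAt_energy_mulVec {k : Type} [Fintype k] {G : RatMat k k} {z : ℂ}
    (h : MatAnalyticAt G (z : OnePoint ℂ)) (x : k → ℂ) :
    ContinuousAt (fun t : ℂ => energy (matValueAt G (t : OnePoint ℂ) *ᵥ x)) z := by
  unfold energy mulVec dotProduct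
  refine tendsto_finsetSum _ fun i _ => ContinuousAt.pow (ContinuousAt.norm ?_) 2
  refine tendsto_finsetSum _ fun j _ => ContinuousAt.mul ?_ continuousAt_const
  exact continuousAt_valueAt (h i j)

theorem continuousAt_le_of_mem_closure {f : ℂ → ℝ} {z : ℂ} {S : Set ℂ} {c : ℝ}
    (hf : ContinuousAt f z) (hz : z ∈ closure S) (h : ∀ x ∈ S, f x ≤ c) : f z ≤ c := by
  have : f z ∈ closure (f '' S) := hf.continuousWithinAt.mem_closure_image hz
  exact closure_minimal (by rintro _ ⟨x, hx, rfl⟩; exact h x hx) isClosed_Iic this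

theorem continuousAt_ge_of_mem_closure {f : ℂ → ℝ} {z : ℂ} {S : Set ℂ} {c : ℝ}
    (hf : ContinuousAt f z) (hz : z ∈ closure S) (h : ∀ x ∈ S, c ≤ f x) : c ≤ f z := by
  have : f z ∈ closure (f '' S) := hf.continuousWithinAt.mem_closure_image hz
  exact closure_minimal (by rintro _ ⟨x, hx, rfl⟩; exact h x hx) isClosed_Ici this

/-- It suffices to check the inequalities defining losslessness off a finite set. -/
theorem isLossless_of_eventually {p : ℕ} {G : RatMat (Fin p) (Fin p)}
    (h1 : ∀ᶠ z : ℂ in Filter.cofinite, ‖z‖ < 1 → ∀ x, energy x ≤ energy (matValueAt G z *ᵥ x))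
    (h2 : ∀ᶠ z : ℂ in Filter.cofinite, 1 < ‖z‖ → ∀ x, energy (matValueAt G z *ᵥ x) ≤ energy x) :
    IsLossless G := by
  refine isLossless_iff.2 fun z hz => ⟨fun hn x => ?_, fun hn x => ?_⟩
  · exact continuousAt_ge_of_mem_closure (continuousAt_energy_mulVec hz x)
      (mem_closure_of_norm_le h1 hn) fun t ht => ht.2 ht.1 x
  · exact continuousAt_le_of_mem_closure (continuousAt_energy_mulVec hz x)
      (mem_closure_of_le_norm h2 hn) fun t ht => ht.2 ht.1 x

/-- A lossless function has no poles outside the open unit disk. -/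
theorem IsLossless.matAnalyticAt {p : ℕ} {G : RatMat (Fin p) (Fin p)} (hG : IsLossless G) {z : ℂ}
    (hz : 1 ≤ ‖z‖) : MatAnalyticAt G (z : OnePoint ℂ) := by
  intro i j
  -- Written between polynomials, the bound `|G i j| ≤ 1` remains meaningful at a possible pole and
  -- passes to the limit there. A zero of the denominator then forces one of the numerator, against
  -- coprimality.
  have key : ‖(G i j).num.eval z‖ - ‖(G i j).denom.eval z‖ ≤ 0 := by
    refine continuousAt_le_of_mem_closure (f := fun t => ‖(G i j).num.eval t‖ -
      ‖(G i j).denom.eval t‖) ?_ (mem_closure_of_le_norm (MatHasVal.eventually G) hz) ?_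
    · exact ((G i j).num.continuous.norm.sub (G i j).denom.continuous.norm).continuousAt
    · rintro t ⟨ht, hta⟩
      have h1 := (isLossless_iff.1 hG t hta).2 ht.le (Pi.single j 1)
      have h2 : energy (Pi.single j (1 : ℂ)) = 1 := by
        rw [energy, Finset.sum_eq_single j] <;> simp +contextual
      rw [h2, Matrix.mulVec_single_one] at h1
      have h3 : ‖matValueAt G t i j‖ ^ 2 ≤ 1 :=
        (Finset.single_le_sum (f := fun i => ‖matValueAt G t i j‖ ^ 2)
          (fun _ _ => by positivity) (Finset.mem_univ i)).trans h1
      have h4 : ‖matValueAt G t i j‖ ≤ 1 := by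
        nlinarith [norm_nonneg (matValueAt G t i j)]
      have h5 : (G i j).denom.eval t ≠ 0 := hta i j
      change ‖(G i j).num.eval t / (G i j).denom.eval t‖ ≤ 1 at h4
      rw [norm_div, div_le_one (norm_pos_iff.2 h5)] at h4
      simpa using h4
  change (G i j).denom.eval z ≠ 0
  intro h0
  rw [h0, norm_zero, sub_zero] at key
  have h1 : (G i j).num.eval z = 0 := norm_le_zero_iff.1 key
  obtain ⟨a, b, hab⟩ := (G i j).isCoprime_num_denom
  have := congrArg (Polynomial.eval z) hab
  simp [h0, h1] at this

/-! ### Isometric realizations -/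

section Isometric
variable {σ p : Type} [Fintype σ] [DecidableEq σ] [Fintype p] [DecidableEq p]
  {A : Matrix σ σ ℂ} {B : Matrix σ p ℂ} {C : Matrix p σ ℂ} {D : Matrix p p ℂ}

theorem star_dotProduct_of_isometric (hR : (fromBlocks A B C D)ᴴ * fromBlocks A B C D = 1)
    (x x' : σ → ℂ) (a a' : p → ℂ) :
    star (A *ᵥ x + B *ᵥ a) ⬝ᵥ (A *ᵥ x' + B *ᵥ a') + star (C *ᵥ x + D *ᵥ a) ⬝ᵥ (C *ᵥ x' + D *ᵥ a') =
      star x ⬝ᵥ x' + star a ⬝ᵥ a' := by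
  have := star_dotProduct_mulVec_of_isometry hR (Sum.elim x a) (Sum.elim x' a')
  simpa [fromBlocks_mulVec, dotProduct, Fintype.sum_sum_type] using this

theorem energy_of_isometric (hR : (fromBlocks A B C D)ᴴ * fromBlocks A B C D = 1)
    (x : σ → ℂ) (a : p → ℂ) :
    energy (A *ᵥ x + B *ᵥ a) + energy (C *ᵥ x + D *ᵥ a) = energy x + energy a := by
  have := star_dotProduct_of_isometric hR x x a a
  simp only [star_dotProduct_self] at this
  exact_mod_cast this

/-- An eigenvector `x` with zero input would satisfy `|z|²‖x‖² + ‖Cx‖² = ‖x‖²`, impossible for `|z|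
> 1`. -/
theorem det_ne_zero_of_isometric (hR : (fromBlocks A B C D)ᴴ * fromBlocks A B C D = 1) {z : ℂ}
    (hz : 1 < ‖z‖) : (z • 1 - A).det ≠ 0 := by
  intro h0
  obtain ⟨x, hx0, hx⟩ := Matrix.exists_mulVec_eq_zero_iff.2 h0
  rw [Matrix.sub_mulVec, Matrix.smul_mulVec, Matrix.one_mulVec, sub_eq_zero] at hx
  have h := energy_of_isometric hR x 0
  simp only [Matrix.mulVec_zero, add_zero, ← hx, energy_smul] at h
  have h2 : energy (0 : p → ℂ) = 0 := energy_eq_zero.2 rfl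
  have h3 := energy_nonneg (C *ᵥ x)
  have h4 : 0 < energy x := (energy_nonneg x).lt_of_ne fun h => hx0 (energy_eq_zero.1 h.symm)
  have h5 : 1 < ‖z‖ ^ 2 := one_lt_pow₀ hz two_ne_zero
  nlinarith [mul_pos (sub_pos.2 h5) h4]

/-- State and output at a point which is not an eigenvalue of the state matrix. -/
theorem Realizes.exists_state {G : RatMat p p} (h : Realizes G A B C D) {z : ℂ}
    (hz : (z • 1 - A).det ≠ 0) (c : p → ℂ) :
    ∃ s : σ → ℂ, s = (z • 1 - A)⁻¹ *ᵥ (B *ᵥ c) ∧ z • s = A *ᵥ s + B *ᵥ c ∧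
      matValueAt G z *ᵥ c = C *ᵥ s + D *ᵥ c := by
  refine ⟨_, rfl, ?_, ?_⟩
  · have : (z • 1 - A) *ᵥ ((z • 1 - A)⁻¹ *ᵥ (B *ᵥ c)) = B *ᵥ c := by
      rw [Matrix.mulVec_mulVec, Matrix.mul_nonsing_inv _ (isUnit_iff_ne_zero.2 hz),
        Matrix.one_mulVec]
    rw [Matrix.sub_mulVec, Matrix.smul_mulVec, Matrix.one_mulVec, sub_eq_iff_eq_add] at this
    rw [this, add_comm]
  · rw [(h.matHasVal hz).matValueAt_eq, Matrix.add_mulVec, add_comm]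
    simp only [Matrix.mulVec_mulVec, Matrix.mul_assoc]

/-- The number `e` is the energy of the state. The sign of `|z|² - 1` then decides all the
inequalities of losslessness. -/
theorem energy_output_of_isometric {G : RatMat p p}
    (hR : (fromBlocks A B C D)ᴴ * fromBlocks A B C D = 1) (h : Realizes G A B C D) {z : ℂ}
    (hz : (z • 1 - A).det ≠ 0) (c : p → ℂ) :
    ∃ e, 0 ≤ e ∧ energy c - energy (matValueAt G z *ᵥ c) = (‖z‖ ^ 2 - 1) * e := by
  obtain ⟨s, -, h1, h2⟩ := h.exists_state hz c
  have := energy_of_isometric hR s c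
  rw [← h1, ← h2, energy_smul] at this
  exact ⟨energy s, energy_nonneg s, by linarith⟩

end Isometric

/-- A function with an isometric realization is lossless. -/
theorem IsometricRealization.isLossless {p : ℕ} {σ : Type} [Fintype σ] [DecidableEq σ]
    {G : RatMat (Fin p) (Fin p)} (h : IsometricRealization σ G) : IsLossless G := by
  obtain ⟨A, B, C, D, hR, hG⟩ := h
  refine isLossless_of_eventually ?_ ?_
  · filter_upwards [eventually_det_ne_zero A] with z hz hn x
    obtain ⟨e, he, h⟩ := energy_output_of_isometric hR hG hz x
    have h5 : ‖z‖ ^ 2 ≤ 1 := pow_le_one₀ (norm_nonneg z) hn.le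
    nlinarith [mul_nonneg (sub_nonneg.2 h5) he]
  · filter_upwards [eventually_det_ne_zero A] with z hz hn x
    obtain ⟨e, he, h⟩ := energy_output_of_isometric hR hG hz x
    have h5 : 1 ≤ ‖z‖ ^ 2 := one_le_pow₀ hn.le
    nlinarith [mul_nonneg (sub_nonneg.2 h5) he]

theorem IsometricRealization.hasRealization {p : ℕ} {σ : Type} [Fintype σ] [DecidableEq σ]
    {G : RatMat (Fin p) (Fin p)} (h : IsometricRealization σ G) :
    HasRealization G (Fintype.card σ) := by
  obtain ⟨A, B, C, D, -, hG⟩ := h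
  exact hG.hasRealization

/-! ### Values outside the disk and at infinity -/

/-- Ultrametric argument in one column of `F = (zI - A)⁻¹`: take an entry of maximal valuation. If
this were at least `1`, then `zF = I + AF` would bound the valuation of `z` times the entry by that
of the entry, although `z` has valuation greater than `1` at infinity. -/
theorem strictlyProper_pencil_inv {σ : Type} [Fintype σ] [DecidableEq σ] (A : Matrix σ σ ℂ)
    (i j : σ) : StrictlyProper ((pencil A)⁻¹ i j) := by
  classical
  set v := RatFunc.inftyValuation ℂ with hv
  set F := (pencil A)⁻¹ with hF
  obtain ⟨k, -, hk⟩ := Finset.exists_max_image Finset.univ (fun i => v (F i j)) ⟨i, by simp⟩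
  refine lt_of_le_of_lt (hk i (by simp)) ?_
  by_contra! hlt
  have h1 := congrFun (congrFun (X_smul_pencil_inv A) k) j
  rw [← hF, Matrix.smul_apply, smul_eq_mul, Matrix.add_apply, Matrix.mul_apply] at h1
  have h2 : v (RatFunc.X * F k j) ≤ v (F k j) := by
    rw [h1]
    refine (v.map_add _ _).trans (max_le ?_ (v.map_sum_le fun l _ => ?_))
    · refine le_trans ?_ hlt
      by_cases h : k = j
      · rw [h, Matrix.one_apply_eq, map_one]
      · rw [Matrix.one_apply_ne h, map_zero]; exact zero_le_one
    · rw [map_mul]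
      exact (mul_le_mul_left (StrictlyProper.valuation_C_le _) _).trans
        (by simpa using hk l (by simp))
  rw [map_mul, hv, RatFunc.inftyValuation.X] at h2
  have h0 : 0 < v (F k j) := lt_of_lt_of_le (by simp) hlt
  have h3 : (WithZero.exp (1 : ℤ)) ≤ 1 := by
    rw [← hv] at h2
    exact le_of_mul_le_mul_right (by simpa using h2) h0
  rw [← WithZero.exp_zero, WithZero.exp_le_exp] at h3
  omega

theorem strictlyProper_const_mul {l m n : Type} [Fintype m] (M : Matrix l m ℂ) {F : RatMat m n}
    (h : ∀ i j, StrictlyProper (F i j)) (i : l) (j : n) : StrictlyProper ((const M * F) i j) :=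
  StrictlyProper.sum _ fun k _ => (h k j).C_mul (M i k)

theorem strictlyProper_mul_const {l m n : Type} [Fintype m] (M : Matrix m n ℂ) {F : RatMat l m}
    (h : ∀ i j, StrictlyProper (F i j)) (i : l) (j : n) : StrictlyProper ((F * const M) i j) :=
  StrictlyProper.sum _ fun k _ => (h i k).mul_C (M k j)

theorem Realizes.value_infty {σ p q : Type} [Fintype σ] [DecidableEq σ] {G : RatMat p q}
    {A : Matrix σ σ ℂ} {B : Matrix σ q ℂ} {C : Matrix p σ ℂ} {D : Matrix p q ℂ}
    (h : Realizes G A B C D) :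
    MatAnalyticAt G OnePoint.infty ∧ matValueAt G OnePoint.infty = D := by
  have key : ∀ i j, AnalyticAtPt (G i j) OnePoint.infty ∧
      valueAt (G i j) OnePoint.infty = D i j := fun i j =>
    value_infty_of_strictlyProper (congrFun (congrFun h i) j)
      (strictlyProper_mul_const _ (strictlyProper_const_mul _ (strictlyProper_pencil_inv A)) i j)
  exact ⟨fun i j => (key i j).1, by ext i j; exact (key i j).2⟩

/-- The value at `1 / conj w` in terms of an isometric realization. -/
theorem value_invConj_of_isometric {σ p : Type} [Fintype σ] [DecidableEq σ] [Fintype p]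
    [DecidableEq p] {A : Matrix σ σ ℂ} {B : Matrix σ p ℂ} {C : Matrix p σ ℂ} {D : Matrix p p ℂ}
    {G : RatMat p p} (hR : (fromBlocks A B C D)ᴴ * fromBlocks A B C D = 1)
    (h : Realizes G A B C D) {w : ℂ} (hw : ‖w‖ < 1) :
    MatAnalyticAt G (invConj w) ∧ ∀ u : p → ℂ, ∃ φ : σ → ℂ, φ = conj w • (A *ᵥ φ) + B *ᵥ u ∧
      matValueAt G (invConj w) *ᵥ u = conj w • (C *ᵥ φ) + D *ᵥ u := by
  -- The vector `φ` is the state at `1 / conj w` multiplied by `1 / conj w`. This rescaling stays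
  -- finite as `w` tends to `0`, where `φ = Bu` and the value is `D`.
  by_cases h0 : w = 0
  · subst h0
    have := h.value_infty
    simp only [invConj, if_true, this.1, this.2]
    exact ⟨trivial, fun u => ⟨B *ᵥ u, by simp, by simp⟩⟩
  · simp only [invConj, h0, if_false]
    have hc : conj w ≠ 0 := by simpa using h0
    have hz : 1 < ‖1 / conj w‖ := by
      rw [norm_div, norm_one, RCLike.norm_conj, lt_div_iff₀ (norm_pos_iff.2 h0)]; linarith
    have hd := det_ne_zero_of_isometric hR hz
    refine ⟨(h.matHasVal hd).matAnalyticAt, fun u => ?_⟩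
    obtain ⟨s, -, h1, h2⟩ := h.exists_state hd u
    refine ⟨(1 / conj w) • s, ?_, ?_⟩
    · rw [Matrix.mulVec_smul, smul_smul, mul_one_div_cancel hc, one_smul, h1]
    · rw [h2, Matrix.mulVec_smul, smul_smul, mul_one_div_cancel hc, one_smul]

/-! ### Minimal realizations -/

/-- A constant vector, regarded as a rational vector function. -/
noncomputable def constVec {m : Type} (y : m → ℂ) : m → RatFunc ℂ := fun i => RatFunc.C (y i)

theorem const_mulVec_constVec {m n : Type} [Fintype n] (M : Matrix m n ℂ) (y : n → ℂ) :
    const M *ᵥ constVec y = constVec (M *ᵥ y) := by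
  ext i; simp [const, constVec, mulVec, dotProduct]

theorem Realizes.transpose {σ p q : Type} [Fintype σ] [DecidableEq σ] {G : RatMat p q}
    {A : Matrix σ σ ℂ} {B : Matrix σ q ℂ} {C : Matrix p σ ℂ} {D : Matrix p q ℂ}
    (h : Realizes G A B C D) : Realizes Gᵀ Aᵀ Cᵀ Bᵀ Dᵀ := by
  have e : ∀ {m n : Type} (M : Matrix m n ℂ), const Mᵀ = (const M)ᵀ := fun _ => rfl
  have e2 : pencil Aᵀ = (pencil A)ᵀ := by simp [pencil, e]
  rw [Realizes, h, e2, ← Matrix.transpose_nonsing_inv]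
  simp only [e, Matrix.transpose_add, Matrix.transpose_mul, Matrix.mul_assoc]

theorem HasRealization.transpose {p q n : ℕ} {G : RatMat (Fin p) (Fin q)}
    (h : HasRealization G n) : HasRealization Gᵀ n := by
  obtain ⟨A, B, C, D, h⟩ := hasRealization_iff.1 h
  exact ⟨_, _, _, _, Realizes.transpose h⟩

theorem HasMcMillanDegree.transpose {p q n : ℕ} {G : RatMat (Fin p) (Fin q)}
    (h : HasMcMillanDegree G n) : HasMcMillanDegree Gᵀ n :=
  ⟨h.1.transpose, fun _ hd => h.2 (by simpa using HasRealization.transpose hd)⟩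

/-- Minimal realizations are controllable. -/
theorem eq_top_of_minimal {p q n : ℕ} {G : RatMat (Fin p) (Fin q)} (hn : HasMcMillanDegree G n)
    {A : Matrix (Fin n) (Fin n) ℂ} {B : Matrix (Fin n) (Fin q) ℂ} {C : Matrix (Fin p) (Fin n) ℂ}
    {D : Matrix (Fin p) (Fin q) ℂ} (h : Realizes G A B C D) (V : Submodule ℂ (Fin n → ℂ))
    (hA : ∀ y ∈ V, A *ᵥ y ∈ V) (hB : ∀ j, B.col j ∈ V) : V = ⊤ := by
  set d := Module.finrank ℂ V
  let b : Module.Basis (Fin d) ℂ V := Module.finBasis ℂ V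
  let K : Matrix (Fin n) (Fin d) ℂ := Matrix.of fun i j => (b j : Fin n → ℂ) i
  have hK : ∀ y : V, (y : Fin n → ℂ) = K *ᵥ (b.repr y) := by
    intro y
    ext i
    have := congrFun (congrArg (Subtype.val) (b.sum_repr y)) i
    rw [← this]
    simp only [AddSubmonoidClass.coe_finsetSum, Finset.sum_apply, K, mulVec, dotProduct,
      Matrix.of_apply]
    exact Finset.sum_congr rfl fun k _ => mul_comm _ _
  have h1 : A * K = K * Matrix.of fun i j => b.repr ⟨A *ᵥ (b j : Fin n → ℂ), hA _ (b j).2⟩ i := by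
    ext i j
    exact congrFun (hK ⟨A *ᵥ (b j : Fin n → ℂ), hA _ (b j).2⟩) i
  have h2 : B = K * Matrix.of fun i j => b.repr ⟨B.col j, hB j⟩ i := by
    ext i j
    exact congrFun (hK ⟨B.col j, hB j⟩) i
  have h3 := (h.of_intertwine K h1 h2).hasRealization
  rw [Fintype.card_fin] at h3
  refine Submodule.eq_top_of_finrank_eq (le_antisymm (Submodule.finrank_le _) ?_)
  simpa using hn.2 h3

/-- Minimal realizations are observable. -/
theorem eq_zero_of_minimal {p q n : ℕ} {G : RatMat (Fin p) (Fin q)} (hn : HasMcMillanDegree G n)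
    {A : Matrix (Fin n) (Fin n) ℂ} {B : Matrix (Fin n) (Fin q) ℂ} {C : Matrix (Fin p) (Fin n) ℂ}
    {D : Matrix (Fin p) (Fin q) ℂ} (h : Realizes G A B C D) {x : Fin n → ℂ} {c : ℂ}
    (hA : A *ᵥ x = c • x) (hC : C *ᵥ x = 0) : x = 0 := by
  -- Duality: the annihilator of `x` under the bilinear pairing, without conjugation, is invariant
  -- under `Aᵀ` and contains the columns of `Cᵀ`. Controllability of the transposed realization
  -- applies to it.
  let V : Submodule ℂ (Fin n → ℂ) :=
    { carrier := {y | x ⬝ᵥ y = 0}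
      add_mem' := fun {a b} ha hb => by
        simp only [Set.mem_ofPred_eq] at *
        rw [dotProduct_add, ha, hb, add_zero]
      zero_mem' := by simp
      smul_mem' := fun r y hy => by
        simp only [Set.mem_ofPred_eq] at *
        rw [dotProduct_smul, hy, smul_zero] }
  have hV : V = ⊤ := by
    refine eq_top_of_minimal hn.transpose h.transpose V (fun y hy => ?_) fun j => ?_
    · change x ⬝ᵥ _ = 0
      change x ⬝ᵥ y = 0 at hy
      rw [Matrix.dotProduct_mulVec, Matrix.vecMul_transpose, hA, smul_dotProduct, hy, smul_zero]
    · change x ⬝ᵥ _ = 0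
      rw [dotProduct_comm]
      exact congrFun hC j
  ext i
  have : (Pi.single i (1 : ℂ) : Fin n → ℂ) ∈ V := hV ▸ Submodule.mem_top
  simpa [V] using this

theorem X_smul_const_mul_pencil_inv_mulVec {l σ : Type} [Fintype σ] [DecidableEq σ]
    (M : Matrix l σ ℂ) (A : Matrix σ σ ℂ) (y : σ → ℂ) :
    (RatFunc.X : RatFunc ℂ) • ((const M * (pencil A)⁻¹) *ᵥ constVec y) =
      constVec (M *ᵥ y) + (const M * (pencil A)⁻¹) *ᵥ constVec (A *ᵥ y) := by
  rw [← Matrix.smul_mulVec, ← Matrix.mul_smul, X_smul_pencil_inv', Matrix.mul_add, Matrix.mul_one,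
    Matrix.add_mulVec, const_mulVec_constVec, ← Matrix.mul_assoc, ← Matrix.mulVec_mulVec,
    const_mulVec_constVec]

/-- The eigenvalues of the state matrix of a minimal realization are poles. -/
theorem det_ne_zero_of_minimal {p q n : ℕ} {G : RatMat (Fin p) (Fin q)}
    (hn : HasMcMillanDegree G n)
    {A : Matrix (Fin n) (Fin n) ℂ} {B : Matrix (Fin n) (Fin q) ℂ} {C : Matrix (Fin p) (Fin n) ℂ}
    {D : Matrix (Fin p) (Fin q) ℂ} (h : Realizes G A B C D) {z : ℂ}
    (hz : MatAnalyticAt G (z : OnePoint ℂ)) : (z • 1 - A).det ≠ 0 := by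
  intro h0
  obtain ⟨x, hx0, hx⟩ := Matrix.exists_mulVec_eq_zero_iff.2 h0
  rw [Matrix.sub_mulVec, Matrix.smul_mulVec, Matrix.one_mulVec, sub_eq_zero] at hx
  set T := const C * (pencil A)⁻¹ with hT
  -- The initial vectors `y` for which `C(XI - A)⁻¹y` has no pole at `z`. They include the columns
  -- of `B` because `G` is analytic there, and the shift relation makes them `A`-invariant.
  let V : Submodule ℂ (Fin n → ℂ) :=
    { carrier := {y | ∀ i, ∃ c, HasVal ((T *ᵥ constVec y) i) z c}
      add_mem' := fun {a b} ha hb i => by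
        obtain ⟨c, hc⟩ := ha i
        obtain ⟨d, hd⟩ := hb i
        refine ⟨c + d, ?_⟩
        have : constVec (a + b) = constVec a + constVec b := by ext; simp [constVec]
        rw [this, Matrix.mulVec_add]
        exact hc.add hd
      zero_mem' := fun i => by
        have : constVec (0 : Fin n → ℂ) = 0 := by ext; simp [constVec]
        rw [this, Matrix.mulVec_zero]
        exact ⟨0, HasVal.zero z⟩
      smul_mem' := fun r y hy i => by
        obtain ⟨c, hc⟩ := hy i
        have : constVec (r • y) = RatFunc.C r • constVec y := by ext; simp [constVec]
        rw [this, Matrix.mulVec_smul]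
        exact ⟨_, (HasVal.ofC z r).mul hc⟩ }
  have hV : V = ⊤ := by
    refine eq_top_of_minimal hn h V (fun y hy i => ?_) fun j i => ?_
    · obtain ⟨c, hc⟩ := hy i
      have e := congrFun (X_smul_const_mul_pencil_inv_mulVec C A y) i
      rw [← hT, Pi.add_apply, Pi.smul_apply, smul_eq_mul] at e
      rw [← sub_eq_iff_eq_add'] at e
      rw [← e]
      exact ⟨_, ((HasVal.ofX z).mul hc).sub (HasVal.ofC z _)⟩
    · have e : (T *ᵥ constVec (B.col j)) i = G i j - RatFunc.C (D i j) := by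
        rw [h]
        simp only [Matrix.add_apply]
        change _ = RatFunc.C (D i j) + _ - _
        rw [add_sub_cancel_left]
        rfl
      rw [e]
      exact ⟨_, (HasVal.of_analyticAtPt (hz i j)).sub (HasVal.ofC z _)⟩
  refine hx0 (eq_zero_of_minimal hn h hx.symm ?_)
  ext i
  have hxV : x ∈ V := hV ▸ Submodule.mem_top
  obtain ⟨c, hc⟩ := hxV i
  have e := congrFun (X_smul_const_mul_pencil_inv_mulVec C A x) i
  have : constVec (A *ᵥ x) = RatFunc.C z • constVec x := by rw [← hx]; ext; simp [constVec]
  rw [← hT, this, Pi.add_apply, Pi.smul_apply, smul_eq_mul, Matrix.mulVec_smul, Pi.smul_apply,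
    smul_eq_mul] at e
  -- For an eigenvector, `X f = Cx + z f` with `f = C(XI - A)⁻¹x`. Evaluating at `z`, where `f` is
  -- analytic, leaves `Cx = 0`, against observability.
  have h1 := (HasVal.ofX z).mul hc
  rw [e] at h1
  have h2 := (HasVal.ofC z ((C *ᵥ x) i)).add ((HasVal.ofC z z).mul hc)
  have := h1.unique h2
  simpa using this

/-! ### The Stein equation -/

section Stein
attribute [local instance] Matrix.linftyOpNormedRing Matrix.linftyOpNormedAlgebra

/-- The hypothesis places the spectrum in the open disk, and Gelfand's formula converts a spectral
radius below `1` into geometric decay of the powers. The zero-dimensional case is separate because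
the spectrum is empty there. -/
theorem exists_norm_pow_le {n : ℕ} {A : Matrix (Fin n) (Fin n) ℂ}
    (hA : ∀ z : ℂ, 1 ≤ ‖z‖ → (z • 1 - A).det ≠ 0) :
    ∃ r : ℝ, 0 ≤ r ∧ r < 1 ∧ ∀ᶠ k in Filter.atTop, ‖A ^ k‖ ≤ r ^ k := by
  have h1 : spectralRadius ℂ A < 1 := by
    rcases subsingleton_or_nontrivial (Matrix (Fin n) (Fin n) ℂ) with hs | hs
    · simp
    · have := spectrum.spectralRadius_lt_of_forall_lt A (r := 1) fun z hz => by
        by_contra! hn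
        refine hz ?_
        rw [spectrum.mem_resolventSet_iff, Matrix.isUnit_iff_isUnit_det, isUnit_iff_ne_zero, Algebra.algebraMap_eq_smul_one]
        exact hA z (by exact_mod_cast hn)
      simpa using this
  obtain ⟨r, hr1, hr2⟩ := ENNReal.lt_iff_exists_nnreal_btwn.1 h1
  refine ⟨r, r.2, by exact_mod_cast hr2, ?_⟩
  filter_upwards [(spectrum.pow_nnnorm_pow_one_div_tendsto_nhds_spectralRadius A).eventually_lt_const
    hr1, Filter.eventually_gt_atTop 0] with k hk hk0
  have h2 : ((‖A ^ k‖₊ : ENNReal) ^ (1 / (k : ℝ))) ^ (k : ℝ) ≤ (r : ENNReal) ^ (k : ℝ) :=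
    ENNReal.rpow_le_rpow hk.le (by positivity)
  rw [← ENNReal.rpow_mul, one_div_mul_cancel (by positivity), ENNReal.rpow_one,
    ENNReal.rpow_natCast] at h2
  exact_mod_cast h2

/-- The solution is the observability Gramian `∑ (A*)ᵏ C*C Aᵏ`. Splitting off its first term gives
the equation, and positivity of the terms gives the factorization `L*L`. -/
theorem exists_stein {n p : ℕ} {A : Matrix (Fin n) (Fin n) ℂ} (C : Matrix (Fin p) (Fin n) ℂ)
    (hA : ∀ z : ℂ, 1 ≤ ‖z‖ → (z • 1 - A).det ≠ 0) :
    ∃ L : Matrix (Fin n) (Fin n) ℂ, Cᴴ * C + Aᴴ * (Lᴴ * L) * A = Lᴴ * L := by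
  obtain ⟨r, hr0, hr1, hr⟩ := exists_norm_pow_le hA
  -- The operator norm for the sup norm is not invariant under adjoints, so the powers of `A*` need
  -- their own bound.
  obtain ⟨r', hr0', hr1', hr'⟩ := exists_norm_pow_le (A := Aᴴ) (fun z hz => by
    have := hA (conj z) (by simpa using hz)
    rw [← star_ne_zero, ← Matrix.det_conjTranspose] at this
    simpa using this)
  have hs : Summable fun k => (Aᴴ) ^ k * (Cᴴ * C) * A ^ k := by
    refine Summable.of_norm_bounded_eventually_nat (g := fun k => ‖Cᴴ * C‖ * (r' * r) ^ k) ?_ ?_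
    · exact (summable_geometric_of_lt_one (by positivity) (by nlinarith)).mul_left _
    · filter_upwards [hr, hr'] with k h1 h2
      calc _ ≤ ‖(Aᴴ) ^ k‖ * ‖Cᴴ * C‖ * ‖A ^ k‖ :=
            (norm_mul_le _ _).trans (mul_le_mul_of_nonneg_right (norm_mul_le _ _) (norm_nonneg _))
        _ ≤ r' ^ k * ‖Cᴴ * C‖ * r ^ k := by gcongr
        _ = _ := by rw [mul_pow]; ring
  set X := ∑' k, (Aᴴ) ^ k * (Cᴴ * C) * A ^ k with hX
  have hstein : Cᴴ * C + Aᴴ * X * A = X := by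
    rw [hX, ← hs.tsum_mul_left, ← (hs.mul_left _).tsum_mul_right, hs.tsum_eq_zero_add]
    simp only [pow_zero, Matrix.one_mul, Matrix.mul_one]
    congr 2
    ext1 k
    rw [pow_succ' (Aᴴ), pow_succ A]
    simp only [Matrix.mul_assoc]
  have hpos : X.PosSemidef := by
    have hk : ∀ k, ((Aᴴ) ^ k * (Cᴴ * C) * A ^ k).PosSemidef := fun k => by
      have := (Matrix.posSemidef_conjTranspose_mul_self C).conjTranspose_mul_mul_same (A ^ k)
      rwa [Matrix.conjTranspose_pow] at this
    refine .of_dotProduct_mulVec_nonneg ?_ fun x => ?_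
    · rw [Matrix.IsHermitian, hX, Matrix.conjTranspose_tsum]
      exact tsum_congr fun k => (hk k).1
    · let φ : Matrix (Fin n) (Fin n) ℂ →+ ℂ :=
        { toFun := fun M => star x ⬝ᵥ (M *ᵥ x)
          map_zero' := by simp
          map_add' := fun M N => by rw [Matrix.add_mulVec, dotProduct_add] }
      have hφ : Continuous φ :=
        Continuous.dotProduct continuous_const (continuous_id.matrix_mulVec continuous_const)
      exact (hs.hasSum.map φ hφ).nonneg fun k => (hk k).dotProduct_mulVec_nonneg x
  obtain ⟨L, hL⟩ : ∃ L : Matrix (Fin n) (Fin n) ℂ, X = Lᴴ * L := by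
    open scoped MatrixOrder in
    exact CStarAlgebra.nonneg_iff_eq_star_mul_self.1 (Matrix.nonneg_iff_posSemidef.2 hpos)
  exact ⟨L, by rw [← hL]; exact hstein⟩

end Stein

/-! ### Lossless functions have isometric realizations -/

theorem infinite_unit_circle : {z : ℂ | ‖z‖ = 1}.Infinite := by
  have : (Metric.sphere (0 : ℂ) 1).Infinite := by
    have h := (isPreconnected_sphere (E := ℂ) (by simp) 0 1)
    refine h.infinite_of_nontrivial ⟨1, by simp, -1, by simp, by norm_num⟩
  simpa [Metric.sphere] using this

theorem det_one_sub_smul_conjTranspose_ne_zero {σ : Type} [Fintype σ] [DecidableEq σ]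
    {A : Matrix σ σ ℂ} (hA : ∀ z : ℂ, 1 ≤ ‖z‖ → (z • 1 - A).det ≠ 0) {z : ℂ} (hz : ‖z‖ ≤ 1) :
    (1 - z • Aᴴ).det ≠ 0 := by
  by_cases h0 : z = 0
  · simp [h0]
  · have h1 : (1 - z • Aᴴ) = z • ((conj z)⁻¹ • 1 - A)ᴴ := by
      simp [smul_sub, smul_smul, h0]
    rw [h1, Matrix.det_smul, Matrix.det_conjTranspose]
    refine mul_ne_zero (pow_ne_zero _ h0) (star_ne_zero.2 (hA _ ?_))
    rw [norm_inv, RCLike.norm_conj]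
    exact (one_le_inv₀ (norm_pos_iff.2 h0)).2 hz

/-- A relation `S(z) + S(z)* + T = 0` on the unit circle with `S` stable and strictly proper
forces `S` and `T` to vanish. -/
theorem eq_zero_of_circle {σ p : Type} [Fintype σ] [DecidableEq σ] [Fintype p]
    {A : Matrix σ σ ℂ} {B E : Matrix σ p ℂ} {T : Matrix p p ℂ}
    (hA : ∀ z : ℂ, 1 ≤ ‖z‖ → (z • 1 - A).det ≠ 0)
    (h : ∀ z : ℂ, ‖z‖ = 1 → Eᴴ * ((z • 1 - A)⁻¹ * B) + ((z • 1 - A)⁻¹ * B)ᴴ * E + T = 0) :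
    const Eᴴ * (pencil A)⁻¹ * const B = 0 ∧ T = 0 := by
  set f : RatMat p p := const Eᴴ * ((pencil A)⁻¹ * const B) with hf
  -- On the circle `conj z = 1/z`, so `g` is a rational function agreeing there with the adjoint
  -- term. It is analytic in the closed disk, whereas `f` is analytic outside the open disk.
  set g : RatMat p p := const Bᴴ * ((RatFunc.X : RatFunc ℂ) •
    ((1 : RatMat σ σ) - (RatFunc.X : RatFunc ℂ) • const Aᴴ)⁻¹) * const E with hg
  have hfv : ∀ z : ℂ, 1 ≤ ‖z‖ → MatHasVal f z (Eᴴ * ((z • 1 - A)⁻¹ * B)) := fun z hz =>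
    (MatHasVal.const _ _).mul (((matHasVal_pencil A z).inv (hA z hz)).mul (MatHasVal.const _ _))
  have hgv : ∀ z : ℂ, ‖z‖ ≤ 1 → MatHasVal g z (Bᴴ * (z • (1 - z • Aᴴ)⁻¹) * E) := fun z hz =>
    ((MatHasVal.const _ _).mul (MatHasVal.smul (HasVal.ofX z) (MatHasVal.inv
      (MatHasVal.one.sub ((MatHasVal.const _ _).smul (HasVal.ofX z)))
      (det_one_sub_smul_conjTranspose_ne_zero hA hz)))).mul (MatHasVal.const _ _)
  have hsum : f + g + const T = 0 := by
    ext i j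
    refine ratFunc_eq_zero_of_infinite infinite_unit_circle fun z hz => ?_
    have hz' : ‖z‖ = 1 := hz
    have h1 := ((hfv z hz'.ge).add (hgv z hz'.le)).add (MatHasVal.const T z)
    have hz0 : z ≠ 0 := by rintro rfl; simp at hz'
    have hzz : z * conj z = 1 := by rw [Complex.mul_conj']; simp [hz']
    have h2 : ((z • 1 - A)⁻¹)ᴴ = z • (1 - z • Aᴴ)⁻¹ := by
      have e : (1 - z • Aᴴ) = z • (z • 1 - A)ᴴ := by
        simp [smul_sub, smul_smul, hzz]
      have hd := det_one_sub_smul_conjTranspose_ne_zero hA hz'.le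
      rw [Matrix.conjTranspose_nonsing_inv]
      refine Matrix.inv_eq_left_inv ?_
      rw [Matrix.smul_mul, ← Matrix.mul_smul, ← e, Matrix.nonsing_inv_mul _ (isUnit_iff_ne_zero.2 hd)]
    have h3 : Bᴴ * (z • (1 - z • Aᴴ)⁻¹) * E = ((z • 1 - A)⁻¹ * B)ᴴ * E := by
      rw [Matrix.conjTranspose_mul, h2]
    rw [h3, h z hz'] at h1
    exact h1 i j
  -- Liouville for rational functions: `f = -(g + T)` continues `f` into the disk, so `f` has no
  -- finite pole, and it vanishes at infinity.
  have hf0 : f = 0 := by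
    ext i j
    refine StrictlyProper.eq_zero (strictlyProper_const_mul _
      (strictlyProper_mul_const _ (strictlyProper_pencil_inv A)) i j) fun z => ?_
    rcases le_total 1 ‖z‖ with hz | hz
    · exact (hfv z hz).matAnalyticAt i j
    · have : f = -(g + const T) := eq_neg_of_add_eq_zero_left (by rw [← add_assoc, hsum])
      rw [this]
      exact (((hgv z hz).add (MatHasVal.const T z)) i j).neg.analyticAtPt
  -- Now `g = -T` is constant, and the factor `X` in `g` makes it vanish at `0`.
  have hT : T = 0 := by
    rw [hf0, zero_add] at hsum
    have h1 := (hgv 0 (by simp)).add (MatHasVal.const T 0)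
    rw [hsum] at h1
    have h2 := h1.unique (by simpa only [const_zero] using MatHasVal.const (0 : Matrix p p ℂ) 0)
    simpa using h2
  exact ⟨by rw [Matrix.mul_assoc]; exact hf0, hT⟩

/-- A lossless function has an isometric realization of the minimal dimension. -/
theorem IsLossless.isometricRealization {p n : ℕ} {G : RatMat (Fin p) (Fin p)}
    (hG : IsLossless G) (hn : HasMcMillanDegree G n) : IsometricRealization (Fin n) G := by
  obtain ⟨A, B, C, D, h⟩ := hasRealization_iff.1 hn.1
  have hA : ∀ z : ℂ, 1 ≤ ‖z‖ → (z • 1 - A).det ≠ 0 := fun z hz =>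
    det_ne_zero_of_minimal hn h (hG.matAnalyticAt hz)
  obtain ⟨L, hL⟩ := exists_stein C hA
  set X := Lᴴ * L with hX
  -- With `R = [A B; C D]`, the goal is `R* diag(X, I) R = diag(X, I)`. The Stein equation is its
  -- upper left block; `E` and `T` are the defects of the off-diagonal and lower right blocks.
  set E := Aᴴ * X * B + Cᴴ * D with hE
  set T := Bᴴ * X * B + Dᴴ * D - 1 with hT
  have hXh : Xᴴ = X := by rw [hX]; simp
  have hcirc : ∀ z : ℂ, ‖z‖ = 1 →
      Eᴴ * ((z • 1 - A)⁻¹ * B) + ((z • 1 - A)⁻¹ * B)ᴴ * E + T = 0 := by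
    intro z hz
    set S := (z • 1 - A)⁻¹ * B with hS
    have hd := hA z hz.ge
    have hzS : z • S = A * S + B := by
      have : (z • 1 - A) * S = B := by
        rw [hS, ← Matrix.mul_assoc, Matrix.mul_nonsing_inv _ (isUnit_iff_ne_zero.2 hd),
          Matrix.one_mul]
      rw [Matrix.sub_mul, Matrix.smul_mul, Matrix.one_mul, sub_eq_iff_eq_add] at this
      rw [this, add_comm]
    have hv : matValueAt G z = D + C * S := by
      rw [(h.matHasVal hd).matValueAt_eq, Matrix.mul_assoc]
    have hu : (D + C * S)ᴴ * (D + C * S) = 1 := by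
      have := hG.circle z hz (hG.matAnalyticAt hz.ge)
      rw [hv, Matrix.mul_neg, Matrix.mul_one, Matrix.neg_mul] at this
      exact neg_injective this
    have h1 : (A * S + B)ᴴ * X * (A * S + B) = Sᴴ * X * S := by
      have hzz : conj z * z = 1 := by rw [Complex.conj_mul']; simp [hz]
      rw [← hzS]
      simp [smul_smul, hzz, mul_comm z]
    have h2 : Sᴴ * (Cᴴ * C + Aᴴ * X * A) * S = Sᴴ * X * S := by rw [hL]
    have h3 : Eᴴ = Bᴴ * X * A + Dᴴ * C := by
      simp [hE, Matrix.conjTranspose_mul, hXh, Matrix.mul_assoc]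
    rw [h3, hE, hT]
    rw [← h2] at h1
    simp only [Matrix.conjTranspose_add, Matrix.conjTranspose_mul, Matrix.mul_add, Matrix.add_mul,
      Matrix.mul_assoc] at h1 hu ⊢
    rw [← hu, ← sub_eq_zero.2 h1]
    abel
  obtain ⟨hS0, hT0⟩ := eq_zero_of_circle hA hcirc
  -- If `E*(XI - A)⁻¹y` vanishes identically, the shift relation shows the constant `E*y` to be
  -- strictly proper, hence zero. The same relation then makes the set of such `y` invariant under
  -- `A`.
  have hout : ∀ y : Fin n → ℂ, (const Eᴴ * (pencil A)⁻¹) *ᵥ constVec y = 0 → Eᴴ *ᵥ y = 0 := by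
    intro y hy
    have e := X_smul_const_mul_pencil_inv_mulVec Eᴴ A y
    rw [hy, smul_zero] at e
    ext i
    refine strictlyProper_C_iff.1 ?_
    have e1 := congrFun e i
    have hsp : StrictlyProper (((const Eᴴ * (pencil A)⁻¹) *ᵥ constVec (A *ᵥ y)) i) := by
      rw [mulVec, dotProduct]
      refine StrictlyProper.sum Finset.univ fun k _ => ?_
      exact (strictlyProper_const_mul Eᴴ (strictlyProper_pencil_inv A) i k).mul_C ((A *ᵥ y) k)
    have e2 : RatFunc.C ((Eᴴ *ᵥ y) i) =
        RatFunc.C (-1) * ((const Eᴴ * (pencil A)⁻¹) *ᵥ constVec (A *ᵥ y)) i := by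
      rw [Pi.zero_apply, Pi.add_apply] at e1
      rw [map_neg, map_one, neg_one_mul]
      exact eq_neg_of_add_eq_zero_left e1.symm
    rw [e2]
    exact hsp.C_mul _
  have hE0 : Eᴴ = 0 := by
    let V : Submodule ℂ (Fin n → ℂ) :=
      { carrier := {y | (const Eᴴ * (pencil A)⁻¹) *ᵥ constVec y = 0}
        add_mem' := fun {a b} ha hb => by
          have : constVec (a + b) = constVec a + constVec b := by ext; simp [constVec]
          simp only [Set.mem_ofPred_eq] at *
          rw [this, Matrix.mulVec_add, ha, hb, add_zero]
        zero_mem' := by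
          have : constVec (0 : Fin n → ℂ) = 0 := by ext; simp [constVec]
          simp only [Set.mem_ofPred_eq]
          rw [this, Matrix.mulVec_zero]
        smul_mem' := fun r y hy => by
          have : constVec (r • y) = RatFunc.C r • constVec y := by ext; simp [constVec]
          simp only [Set.mem_ofPred_eq] at *
          rw [this, Matrix.mulVec_smul, hy, smul_zero] }
    have hV : V = ⊤ := by
      refine eq_top_of_minimal hn h V (fun y hy => ?_) fun j => ?_
      · have e := X_smul_const_mul_pencil_inv_mulVec Eᴴ A y
        have hy' : (const Eᴴ * (pencil A)⁻¹) *ᵥ constVec y = 0 := hy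
        rw [hy', smul_zero, hout y hy'] at e
        have : constVec (0 : Fin p → ℂ) = 0 := by ext; simp [constVec]
        rw [this, zero_add] at e
        exact e.symm
      · ext i
        exact congrFun (congrFun hS0 i) j
    ext i j
    have hj : (Pi.single j (1 : ℂ) : Fin n → ℂ) ∈ V := hV ▸ Submodule.mem_top
    have := congrFun (hout _ hj) i
    rwa [Matrix.mulVec_single_one] at this
  have hE0' : E = 0 := by simpa using hE0
  let Φ : RatMat (Fin n ⊕ Fin p) (Fin p) := fromRows ((pencil A)⁻¹ * const B) 1
  have hΦ : ∀ {l : Type} (M : Matrix l (Fin n) ℂ) (N : Matrix l (Fin p) ℂ),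
      const (fromCols M N) * Φ = const M * ((pencil A)⁻¹ * const B) + const N := by
    intro l M N
    rw [const_fromCols, fromCols_mul_fromRows, Matrix.mul_one]
  let P₁ : Matrix (Fin n) (Fin n ⊕ Fin p) ℂ := fromCols 1 0
  let P₂ : Matrix (Fin n) (Fin n ⊕ Fin p) ℂ := fromCols A B
  -- The relation sends `(Lx, a)` to `(L(Ax + Ba), Cx + Da)`. The lurking isometry supplies the new
  -- state matrix directly, so invertibility of `L` is never needed.
  have key := isometricRealization_of_energy (L * P₁) (L * P₂)
    (fromCols 0 1) (fromCols C D) (fun v => by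
      have hg : ∀ {k : Type} [Fintype k] (M : Matrix k (Fin n ⊕ Fin p) ℂ),
          star (M *ᵥ v) ⬝ᵥ (M *ᵥ v) = star v ⬝ᵥ ((Mᴴ * M) *ᵥ v) := by
        intro k _ M
        rw [Matrix.star_mulVec, ← Matrix.dotProduct_mulVec, Matrix.mulVec_mulVec]
      simp only [hg]
      rw [← dotProduct_add, ← dotProduct_add, ← Matrix.add_mulVec, ← Matrix.add_mulVec]
      congr 2
      have hg2 : ∀ M : Matrix (Fin n) (Fin n ⊕ Fin p) ℂ, (L * M)ᴴ * (L * M) = Mᴴ * X * M := by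
        intro M; simp [hX, Matrix.mul_assoc]
      rw [hg2, hg2]
      simp only [P₁, P₂, conjTranspose_fromCols_eq_fromRows_conjTranspose, fromRows_mul,
        mul_fromCols, fromCols_fromRows_eq_fromBlocks, Matrix.fromBlocks_add]
      have hT' : Bᴴ * X * B + Dᴴ * D = 1 := sub_eq_zero.1 (hT ▸ hT0)
      have h3 : Bᴴ * X * A + Dᴴ * C = 0 := by
        rw [← hE0]
        simp [hE, Matrix.conjTranspose_mul, hXh, Matrix.mul_assoc]
      rw [hT', h3, ← hE, hE0', add_comm (Aᴴ * X * A), hL]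
      simp) Φ (by
      rw [const_mul, const_mul, Matrix.mul_assoc, Matrix.mul_assoc, hΦ, hΦ, const_one, const_zero,
        add_zero, Matrix.one_mul, ← Matrix.mul_smul, ← Matrix.smul_mul, X_smul_pencil_inv,
        Matrix.add_mul, Matrix.one_mul, Matrix.mul_assoc, add_comm]) (by
      rw [hΦ, const_one, const_zero, Matrix.zero_mul, zero_add]; exact isUnit_one)
  rw [hΦ, hΦ, const_one, const_zero, Matrix.zero_mul, zero_add, inv_one, Matrix.mul_one,
    add_comm, ← Matrix.mul_assoc, ← (h : G = _)] at key
  exact key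

/-! ### Linear fractional transformations and graphs -/

section Lft
variable {p : ℕ} {Θ Ψ : RatMat (Fin p ⊕ Fin p) (Fin p ⊕ Fin p)} {G G' : RatMat (Fin p) (Fin p)}

/-- The graph `[I; G]` of `G`. -/
noncomputable def graph (G : RatMat (Fin p) (Fin p)) : RatMat (Fin p ⊕ Fin p) (Fin p) := fromRows 1 G

theorem graph_mul (N : RatMat (Fin p) (Fin p)) : graph G * N = fromRows N (G * N) := by
  rw [graph, fromRows_mul, Matrix.one_mul]

/-- Projective description: the graphs `[I; G]` are normalized representatives modulo right
multiplication by units, and `Θ` acts on them linearly. The unit `N` is the denominator of the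
transformation. -/
theorem lft_eq_iff : G' ∈ lftDomain Θ ∧ lft Θ G' = G ↔
    ∃ N : RatMat (Fin p) (Fin p), IsUnit N ∧ Θ * graph G' = graph G * N := by
  have e : Θ * graph G' =
      fromRows (lftDenom Θ G') (Θ.toBlocks₂₂ * G' + Θ.toBlocks₂₁) := by
    conv_lhs => rw [← fromBlocks_toBlocks Θ]
    rw [graph, fromBlocks_mul_fromRows, Matrix.mul_one, Matrix.mul_one, lftDenom, add_comm,
      add_comm Θ.toBlocks₂₁]
  rw [e]
  constructor
  · rintro ⟨h1, h2⟩
    refine ⟨_, h1, ?_⟩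
    rw [graph_mul, ← h2, lft, Matrix.mul_assoc,
      Matrix.nonsing_inv_mul _ ((Matrix.isUnit_iff_isUnit_det _).1 h1), Matrix.mul_one]
  · rintro ⟨N, hN, h⟩
    rw [graph_mul] at h
    obtain ⟨h1, h2⟩ := (fromRows_ext_iff _ _ _ _).1 h
    refine ⟨by rw [← h1] at hN; exact hN, ?_⟩
    rw [lft, h1, h2, Matrix.mul_assoc,
      Matrix.mul_nonsing_inv _ ((Matrix.isUnit_iff_isUnit_det _).1 hN), Matrix.mul_one]

theorem lft_injOn (hΘ : IsUnit Θ) : Set.InjOn (lft Θ) (lftDomain Θ) := by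
  intro G₁ h₁ G₂ h₂ h
  obtain ⟨N₁, hN₁, e₁⟩ := lft_eq_iff.1 ⟨h₁, rfl⟩
  obtain ⟨N₂, hN₂, e₂⟩ := lft_eq_iff.1 ⟨h₂, rfl⟩
  rw [h] at e₁
  have hd₁ := (Matrix.isUnit_iff_isUnit_det _).1 hN₁
  have hd₂ := (Matrix.isUnit_iff_isUnit_det _).1 hN₂
  have hd := (Matrix.isUnit_iff_isUnit_det _).1 hΘ
  have e : Θ * (graph G₁ * N₁⁻¹) = Θ * (graph G₂ * N₂⁻¹) := by
    rw [← Matrix.mul_assoc, ← Matrix.mul_assoc, e₁, e₂, Matrix.mul_assoc, Matrix.mul_assoc,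
      Matrix.mul_nonsing_inv _ hd₁, Matrix.mul_nonsing_inv _ hd₂]
  have e' := congrArg (fun M : RatMat (Fin p ⊕ Fin p) (Fin p) => Θ⁻¹ * M) e
  simp only [← Matrix.mul_assoc Θ⁻¹, Matrix.nonsing_inv_mul _ hd, Matrix.one_mul,
    graph_mul] at e'
  obtain ⟨h1, h2⟩ := (fromRows_ext_iff _ _ _ _).1 e'
  rw [h1] at h2
  calc G₁ = G₁ * N₂⁻¹ * N₂ := by
        rw [Matrix.mul_assoc, Matrix.nonsing_inv_mul _ hd₂, Matrix.mul_one]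
    _ = G₂ := by rw [h2, Matrix.mul_assoc, Matrix.nonsing_inv_mul _ hd₂, Matrix.mul_one]

theorem lftInv_eq (hΘ : IsUnit Θ) (h : G' ∈ lftDomain Θ) (e : lft Θ G' = G) :
    lftInv Θ G = G' := by
  have hex : ∃ a ∈ lftDomain Θ, lft Θ a = G := ⟨G', h, e⟩
  exact lft_injOn hΘ (Function.invFunOn_mem hex) h ((Function.invFunOn_eq hex).trans e.symm)

theorem lft_mul {F : RatMat (Fin p) (Fin p)} (h₁ : F ∈ lftDomain Ψ ∧ lft Ψ F = G')
    (h₂ : G' ∈ lftDomain Θ ∧ lft Θ G' = G) : F ∈ lftDomain (Θ * Ψ) ∧ lft (Θ * Ψ) F = G := by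
  obtain ⟨N₁, hN₁, e₁⟩ := lft_eq_iff.1 h₁
  obtain ⟨N₂, hN₂, e₂⟩ := lft_eq_iff.1 h₂
  exact lft_eq_iff.2 ⟨N₂ * N₁, hN₂.mul hN₁, by
    rw [Matrix.mul_assoc, e₁, ← Matrix.mul_assoc, e₂, Matrix.mul_assoc]⟩

theorem lft_one : G ∈ lftDomain (1 : RatMat (Fin p ⊕ Fin p) (Fin p ⊕ Fin p)) ∧
    lft (1 : RatMat (Fin p ⊕ Fin p) (Fin p ⊕ Fin p)) G = G :=
  lft_eq_iff.2 ⟨1, isUnit_one, by rw [Matrix.one_mul, Matrix.mul_one]⟩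

end Lft

/-! ### The signature form -/

section JForm
variable {p : ℕ}

theorem J_mul_J : J p * J p = 1 := by
  rw [J, fromBlocks_multiply]; simp

theorem J_conjTranspose : (J p)ᴴ = J p := by
  rw [J, fromBlocks_conjTranspose]; simp

/-- The sesquilinear form defined by `J`. -/
def jForm (x y : Fin p ⊕ Fin p → ℂ) : ℂ := star x ⬝ᵥ (J p *ᵥ y)

theorem jForm_sumElim (a b a' b' : Fin p → ℂ) :
    jForm (Sum.elim a b) (Sum.elim a' b') = star a ⬝ᵥ a' - star b ⬝ᵥ b' := by
  simp [jForm, J, fromBlocks_mulVec, dotProduct, Fintype.sum_sum_type, Matrix.neg_mulVec,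
    sub_eq_add_neg]

theorem jForm_add_right (x y z : Fin p ⊕ Fin p → ℂ) : jForm x (y + z) = jForm x y + jForm x z := by
  rw [jForm, Matrix.mulVec_add, dotProduct_add]; rfl

theorem jForm_smul_right (c : ℂ) (x y : Fin p ⊕ Fin p → ℂ) : jForm x (c • y) = c * jForm x y := by
  rw [jForm, Matrix.mulVec_smul, dotProduct_smul]; rfl

theorem jForm_conj (x y : Fin p ⊕ Fin p → ℂ) : conj (jForm x y) = jForm y x := by
  rw [jForm, jForm, Matrix.dotProduct_mulVec (star y), starRingEnd_apply, Matrix.star_dotProduct,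
    star_star, Matrix.star_mulVec, J_conjTranspose, dotProduct_comm]

theorem jForm_add_smul (x y : Fin p ⊕ Fin p → ℂ) (c : ℂ) :
    jForm (y + c • x) (y + c • x) = jForm y y + c * conj (jForm x y) + conj c * jForm x y +
      c * conj c * jForm x x := by
  have h : jForm (y + c • x) y = conj (jForm y y + c * jForm y x) := by
    rw [← jForm_smul_right, ← jForm_add_right, jForm_conj]
  have hx : conj (jForm x x) = jForm x x := jForm_conj x x
  have h' : jForm (y + c • x) x = conj (jForm x y + c * jForm x x) := by
    rw [← jForm_smul_right, ← jForm_add_right, jForm_conj]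
  rw [jForm_add_right, jForm_smul_right, h, h', map_add, map_add, map_mul, map_mul, hx]
  simp only [jForm_conj]
  ring

theorem jForm_mulVec {H : Matrix (Fin p ⊕ Fin p) (Fin p ⊕ Fin p) ℂ} (hH : IsJUnitary H)
    (x y : Fin p ⊕ Fin p → ℂ) : jForm (H *ᵥ x) (H *ᵥ y) = jForm x y := by
  rw [jForm, Matrix.star_mulVec, ← Matrix.dotProduct_mulVec, Matrix.mulVec_mulVec,
    Matrix.mulVec_mulVec, hH, jForm]

/-- The inverse of a `J`-unitary matrix. -/
theorem IsJUnitary.mul_inv {H : Matrix (Fin p ⊕ Fin p) (Fin p ⊕ Fin p) ℂ} (hH : IsJUnitary H) :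
    H * (J p * Hᴴ * J p) = 1 ∧ (J p * Hᴴ * J p) * H = 1 := by
  have h : (J p * Hᴴ * J p) * H = 1 := by
    rw [Matrix.mul_assoc, Matrix.mul_assoc, ← Matrix.mul_assoc Hᴴ, hH, J_mul_J]
  exact ⟨mul_eq_one_comm.1 h, h⟩

theorem IsJUnitary.inv {H : Matrix (Fin p ⊕ Fin p) (Fin p ⊕ Fin p) ℂ} (hH : IsJUnitary H) :
    IsJUnitary (J p * Hᴴ * J p) := by
  have h := hH.mul_inv.1
  rw [IsJUnitary]
  simp only [Matrix.conjTranspose_mul, J_conjTranspose, Matrix.conjTranspose_conjTranspose]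
  calc _ = J p * (H * (J p * J p) * (J p * Hᴴ * J p)) := by simp only [Matrix.mul_assoc]
    _ = J p := by rw [J_mul_J, Matrix.mul_one, h, Matrix.mul_one]

end JForm

/-! ### Elementary factors -/

section Theta
variable {p : ℕ} {u v : Vec p} {w ξ : ℂ} {H : Matrix (Fin p ⊕ Fin p) (Fin p ⊕ Fin p) ℂ}

/-- The column `[u; v]`. -/
def stackCol (u v : Vec p) : Matrix (Fin p ⊕ Fin p) Unit ℂ := replicateCol Unit (stack u v)

/-- The row `[u; v]* J`. -/
def stackRow (u v : Vec p) : Matrix Unit (Fin p ⊕ Fin p) ℂ :=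
  (stackCol u v)ᴴ * J p

theorem stackRow_mulVec (y : Fin p ⊕ Fin p → ℂ) (i : Unit) :
    (stackRow u v *ᵥ y) i = jForm (stack u v) y := by
  rw [stackRow, ← Matrix.mulVec_mulVec]
  rfl

theorem stackCol_mulVec (c : Unit → ℂ) : stackCol u v *ᵥ c = c () • stack u v := by
  ext i
  simp [stackCol, mulVec, dotProduct, mul_comm]

theorem jForm_stack (hu : ‖u‖ = 1) : jForm (stack u v) (stack u v) = 1 - (‖v‖ : ℂ) ^ 2 := by
  rw [stack, jForm_sumElim, star_dotProduct_self, star_dotProduct_self]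
  have h1 : energy (fun i => u i) = 1 := by
    have := energy_ofLp u
    rwa [hu, one_pow] at this
  have h2 : energy (fun i => v i) = ‖v‖ ^ 2 := energy_ofLp v
  rw [h1, h2]; push_cast; rfl

theorem one_sub_norm_sq_ne_zero (hv : ‖v‖ < 1) : (1 - (‖v‖ : ℂ) ^ 2) ≠ 0 := by
  have : (1 - ‖v‖ ^ 2 : ℝ) ≠ 0 := by nlinarith [norm_nonneg v]
  exact_mod_cast this

theorem stackRow_mul_stackCol (hu : ‖u‖ = 1) :
    stackRow u v * stackCol u v = (1 - (‖v‖ : ℂ) ^ 2) • 1 := by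
  ext i j
  have h : (stackRow u v * stackCol u v) i j = (stackRow u v *ᵥ stack u v) i := rfl
  rw [h, stackRow_mulVec, jForm_stack hu]; simp

theorem theta_eq : theta u v w ξ H =
    (1 + ((blaschke w / RatFunc.C (blaschkeVal w ξ) - 1) *
      RatFunc.C (1 / (1 - (‖v‖ : ℂ) ^ 2))) • (const (stackCol u v) * const (stackRow u v))) *
      const H := by
  rw [theta, const_smul, smul_smul, ← const_mul, stackRow, ← Matrix.mul_assoc]
  congr 5
  rw [Matrix.vecMulVec_eq Unit]
  rfl

theorem one_sub_ne_zero_of_norm_lt (hw : ‖w‖ < 1) (hξ : ‖ξ‖ = 1) : 1 - conj w * ξ ≠ 0 := by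
  intro h
  have : ‖conj w * ξ‖ = 1 := by rw [← sub_eq_zero.1 h, norm_one]
  rw [norm_mul, RCLike.norm_conj, hξ, mul_one] at this
  linarith

theorem blaschkeVal_mul_conj (hw : ‖w‖ < 1) (hξ : ‖ξ‖ = 1) :
    blaschkeVal w ξ * conj (blaschkeVal w ξ) = 1 := by
  have h := one_sub_ne_zero_of_norm_lt hw hξ
  have h' : 1 - w * conj ξ ≠ 0 := by
    have := (map_ne_zero (starRingEnd ℂ)).2 h
    simpa using this
  have hx : ξ * conj ξ = 1 := by rw [Complex.mul_conj']; simp [hξ]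
  simp only [blaschkeVal, map_div₀, map_sub, map_mul, map_one, Complex.conj_conj]
  rw [div_mul_div_comm, div_eq_one_iff_eq (mul_ne_zero h h')]
  linear_combination (1 - w * conj w) * hx

theorem blaschke_denom_ne_zero (w : ℂ) :
    (1 - RatFunc.C (conj w) * RatFunc.X : RatFunc ℂ) ≠ 0 := by
  intro h
  have h1 := (HasVal.one 0).sub ((HasVal.ofC 0 (conj w)).mul (HasVal.ofX 0))
  rw [h] at h1
  simpa using h1.unique (HasVal.zero 0)

theorem blaschke_ne_zero (w : ℂ) : blaschke w ≠ 0 := by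
  refine div_ne_zero (fun h => ?_) (blaschke_denom_ne_zero w)
  have h1 := (HasVal.ofX (w + 1)).sub (HasVal.ofC (w + 1) w)
  rw [h] at h1
  simpa using h1.unique (HasVal.zero _)

theorem isUnit_const {H K : Matrix (Fin p ⊕ Fin p) (Fin p ⊕ Fin p) ℂ} (h : H * K = 1) :
    IsUnit (const H) := by
  rw [Matrix.isUnit_iff_isUnit_det]
  refine Matrix.isUnit_det_of_right_inverse (B := const K) ?_
  rw [← const_mul, h, const_one]

theorem isUnit_theta (hu : ‖u‖ = 1) (hv : ‖v‖ < 1) (hw : ‖w‖ < 1) (hξ : ‖ξ‖ = 1)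
    (hH : IsJUnitary H) : IsUnit (theta u v w ξ H) := by
  rw [theta_eq]
  refine IsUnit.mul ?_ (isUnit_const hH.mul_inv.1)
  set β := blaschke w / RatFunc.C (blaschkeVal w ξ) with hβ
  have hb : blaschkeVal w ξ ≠ 0 := left_ne_zero_of_mul_eq_one (blaschkeVal_mul_conj hw hξ)
  have hβ0 : β ≠ 0 := div_ne_zero (blaschke_ne_zero w) (by simpa using hb)
  set δ := RatFunc.C (1 / (1 - (‖v‖ : ℂ) ^ 2)) with hδ
  set P := const (stackCol u v) * const (stackRow u v) with hP
  have hPP : δ • (P * P) = P := by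
    rw [hP, Matrix.mul_assoc, ← Matrix.mul_assoc (const (stackRow u v)), ← const_mul,
      stackRow_mul_stackCol hu, const_smul, const_one, Matrix.smul_mul, Matrix.one_mul,
      Matrix.mul_smul, smul_smul, hδ, ← map_mul, one_div_mul_cancel (one_sub_norm_sq_ne_zero hv),
      map_one, one_smul]
  rw [Matrix.isUnit_iff_isUnit_det]
  -- Since `δ • P` is idempotent, `1 + (β - 1)δP` scales its range by `β` and fixes its kernel. The
  -- inverse is obtained by replacing `β` by `β⁻¹`.
  refine Matrix.isUnit_det_of_right_inverse (B := 1 + ((β⁻¹ - 1) * δ) • P) ?_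
  have e : (1 + ((β - 1) * δ) • P) * (1 + ((β⁻¹ - 1) * δ) • P) =
      1 + ((β - 1) * δ) • P + ((β⁻¹ - 1) * δ) • P + ((β - 1) * (β⁻¹ - 1) * δ) • (δ • (P * P)) := by
    rw [Matrix.add_mul, Matrix.mul_add, Matrix.mul_add, Matrix.one_mul, Matrix.mul_one,
      Matrix.one_mul, Matrix.smul_mul, Matrix.mul_smul, smul_smul, smul_smul]
    have : (β - 1) * δ * ((β⁻¹ - 1) * δ) = (β - 1) * (β⁻¹ - 1) * δ * δ := by ring
    rw [this]; abel
  rw [e, hPP, add_assoc, add_assoc, ← add_smul, ← add_smul]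
  have : (β - 1) * δ + ((β⁻¹ - 1) * δ + (β - 1) * (β⁻¹ - 1) * δ) = 0 := by
    field_simp; ring
  rw [this, zero_smul, add_zero]

end Theta

/-! ### Extraction of an elementary factor -/

/-- A coisometry onto the orthogonal complement of a nonzero vector. -/
theorem exists_compression {n : ℕ} {φ : Fin (n + 1) → ℂ} (hφ : φ ≠ 0) :
    ∃ Q : Matrix (Fin n) (Fin (n + 1)) ℂ, ∀ x, star (Q *ᵥ x) ⬝ᵥ (Q *ᵥ x) =
      star x ⬝ᵥ x - (star φ ⬝ᵥ x) * conj (star φ ⬝ᵥ x) / (star φ ⬝ᵥ φ) := by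
  set ψ : EuclideanSpace ℂ (Fin (n + 1)) := WithLp.toLp 2 φ with hψ
  have hψ0 : ψ ≠ 0 := fun h => hφ (by simpa [hψ] using h)
  have hn : ‖ψ‖ ≠ 0 := norm_ne_zero_iff.2 hψ0
  -- The unit vector along `φ` is completed to an orthonormal basis with it in position `0`. The
  -- rows of `Q` are the remaining coordinate functionals, and Parseval gives the formula.
  have ho : Orthonormal ℂ (({0} : Set (Fin (n + 1))).domRestrict
      (fun _ : Fin (n + 1) => ((‖ψ‖⁻¹ : ℝ) : ℂ) • ψ)) := by
    rw [orthonormal_iff_ite]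
    rintro ⟨i, hi⟩ ⟨j, hj⟩
    have hij : i = j := by rw [Set.mem_singleton_iff] at hi hj; rw [hi, hj]
    subst hij
    have h1 : ‖((‖ψ‖⁻¹ : ℝ) : ℂ) • ψ‖ = 1 := by
      rw [norm_smul, Complex.norm_real, norm_inv, norm_norm, inv_mul_cancel₀ hn]
    have h2 := inner_self_eq_norm_sq_to_K (𝕜 := ℂ) (((‖ψ‖⁻¹ : ℝ) : ℂ) • ψ)
    rw [h1] at h2
    simpa using h2
  obtain ⟨b, hb⟩ := ho.exists_orthonormalBasis_extension_of_card_eq (by simp)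
  have hb0 := hb 0 rfl
  refine ⟨Matrix.of fun i j => conj (b i.succ j), fun x => ?_⟩
  have hin : ∀ y z : EuclideanSpace ℂ (Fin (n + 1)),
      inner ℂ y z = star (WithLp.ofLp y) ⬝ᵥ WithLp.ofLp z := fun y z => by
    rw [dotProduct_comm]; rfl
  have h1 := b.sum_sq_norm_inner_right (WithLp.toLp 2 x)
  rw [Fin.sum_univ_succ] at h1
  have h2 : energy ((Matrix.of fun i j => conj (b (Fin.succ i) j)) *ᵥ x) =
      ∑ i : Fin n, ‖inner ℂ (b i.succ) (WithLp.toLp 2 x)‖ ^ 2 := by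
    unfold energy
    refine Finset.sum_congr rfl fun i _ => ?_
    rw [hin]; rfl
  have h3 : ‖inner ℂ (b 0) (WithLp.toLp 2 x)‖ ^ 2 = ‖star φ ⬝ᵥ x‖ ^ 2 / ‖ψ‖ ^ 2 := by
    rw [hb0, inner_smul_left, hin, norm_mul, RCLike.norm_conj, Complex.norm_real, norm_inv,
      norm_norm, mul_pow]
    field_simp
    rfl
  rw [star_dotProduct_self, star_dotProduct_self, star_dotProduct_self, Complex.mul_conj', h2,
    eq_sub_of_add_eq' h1, h3, ← energy_ofLp, ← energy_ofLp]
  push_cast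
  rfl

theorem isUnit_of_mulVec {p : Type} [Fintype p] [DecidableEq p] {M : RatMat p p} {z : ℂ}
    {N : Matrix p p ℂ} (h : MatHasVal M z N) (hN : ∀ c, N *ᵥ c = 0 → c = 0) : IsUnit M := by
  refine h.isUnit fun h0 => ?_
  obtain ⟨c, hc0, hc⟩ := Matrix.exists_mulVec_eq_zero_iff.2 h0
  exact hc0 (hN c hc)

/-- Supplies the test point for invertibility in the extraction: outside the closed disk the energy
balance is strict, and `1 / conj w` has to be avoided. -/
theorem exists_one_lt_norm (w : ℂ) : ∃ z : ℂ, 1 < ‖z‖ ∧ conj w * z ≠ 1 := by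
  by_cases h : conj w * 2 = 1
  · refine ⟨3, by norm_num, fun h' => ?_⟩
    have : (3 : ℂ) * (conj w * 2) = 2 * (conj w * 3) := by ring
    rw [h, h'] at this
    norm_num at this
  · exact ⟨2, by norm_num, h⟩

section Extraction
variable {p : ℕ} {u v : Vec p} {w ξ : ℂ} {H : Matrix (Fin p ⊕ Fin p) (Fin p ⊕ Fin p) ℂ}

theorem jForm_self_eq (y : Fin p ⊕ Fin p → ℂ) :
    jForm y y = star (y ∘ Sum.inl) ⬝ᵥ (y ∘ Sum.inl) - star (y ∘ Sum.inr) ⬝ᵥ (y ∘ Sum.inr) := by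
  conv_lhs => rw [← Sum.elim_comp_inl_inr y]
  rw [jForm_sumElim]

/-- Here `p` and `q` are the products of `φ` with the state and the next state, `f = ‖φ‖²`, and `g`
is the `J`-product with `[u; v]`. The left side is the change of the `J`-form on adding `k [u; v]`;
it equals the loss of state energy along `φ`. The point is that `δk + g = b(p - conj w q)` with `|b|
= 1`. -/
theorem extraction_form_identity {b w p q g f δ k : ℂ} (hb : b * conj b = 1)
    (hg : g = q - w * p) (hδ : δ = (1 - w * conj w) * f) (hδ0 : δ ≠ 0) (hδr : conj δ = δ)
    (hk : k = δ⁻¹ * (b * (p - conj w * q) - (q - w * p))) :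
    k * conj g + conj k * g + k * conj k * δ = p * conj p / f - q * conj q / f := by
  have hf : f ≠ 0 := by rintro rfl; simp at hδ; exact hδ0 hδ
  have h1 : δ * k = b * (p - conj w * q) - (q - w * p) := by rw [hk]; field_simp
  have h2 : δ * conj k = conj b * (conj p - w * conj q) - (conj q - conj w * conj p) := by
    have := congrArg conj h1
    simpa [hδr] using this
  have hg' : conj g = conj q - conj w * conj p := by rw [hg]; simp
  apply mul_left_cancel₀ hδ0
  have e : δ * (p * conj p / f - q * conj q / f) =
      (1 - w * conj w) * (p * conj p - q * conj q) := by
    rw [hδ]; field_simp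
  rw [e, hg', hg]
  linear_combination (δ * conj k + (conj q - conj w * conj p)) * h1 +
    b * (p - conj w * q) * h2 + (p - conj w * q) * (conj p - w * conj q) * hb

theorem stackRow_mulVec_sumElim (a y : Fin p → ℂ) :
    jForm (stack u v) (Sum.elim a y) = star (WithLp.ofLp u) ⬝ᵥ a - star (WithLp.ofLp v) ⬝ᵥ y := by
  rw [stack, jForm_sumElim]

theorem blaschke_div_mul (hw : ‖w‖ < 1) (hξ : ‖ξ‖ = 1) :
    blaschke w / RatFunc.C (blaschkeVal w ξ) *
      (RatFunc.C (blaschkeVal w ξ) * (1 - RatFunc.C (conj w) * RatFunc.X)) =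
      RatFunc.X - RatFunc.C w := by
  have hb : RatFunc.C (blaschkeVal w ξ) ≠ 0 := by
    simpa using left_ne_zero_of_mul_eq_one (blaschkeVal_mul_conj hw hξ)
  have := blaschke_denom_ne_zero w
  rw [blaschke, div_div, div_mul_eq_mul_div, div_eq_iff (mul_ne_zero this hb)]
  ring

/-- The inverse factor involves `β⁻¹ = b(1 - conj w X) / (X - w)`. The factor `X - w` in `h` cancels
its denominator, so the inverse acts on `g` polynomially in `X` through `r`. -/
theorem theta_mul_identity (hu : ‖u‖ = 1) (hv : ‖v‖ < 1) (hw : ‖w‖ < 1) (hξ : ‖ξ‖ = 1)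
    {g : RatMat (Fin p ⊕ Fin p) (Fin p)} {r : RatMat Unit (Fin p)}
    (h : const (stackRow u v) * g = (RatFunc.X - RatFunc.C w) • r) :
    (1 + ((blaschke w / RatFunc.C (blaschkeVal w ξ) - 1) *
      RatFunc.C (1 / (1 - (‖v‖ : ℂ) ^ 2))) • (const (stackCol u v) * const (stackRow u v))) *
      (g + RatFunc.C (1 - (‖v‖ : ℂ) ^ 2)⁻¹ • (const (stackCol u v) *
        ((RatFunc.C (blaschkeVal w ξ) * (1 - RatFunc.C (conj w) * RatFunc.X) -
          (RatFunc.X - RatFunc.C w)) • r))) = g := by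
  have hβ := blaschke_div_mul (w := w) (ξ := ξ) hw hξ
  set β := blaschke w / RatFunc.C (blaschkeVal w ξ)
  set t := RatFunc.C (blaschkeVal w ξ) * (1 - RatFunc.C (conj w) * RatFunc.X)
  set δ := 1 - (‖v‖ : ℂ) ^ 2 with hδ
  have hd : RatFunc.C δ⁻¹ * RatFunc.C δ = 1 := by
    rw [← map_mul, inv_mul_cancel₀ (one_sub_norm_sq_ne_zero hv), map_one]
  have h2 : const (stackRow u v) * (const (stackCol u v) * r) = RatFunc.C δ • r := by
    rw [← Matrix.mul_assoc, ← const_mul, stackRow_mul_stackCol hu, const_smul, const_one,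
      Matrix.smul_mul, Matrix.one_mul]
  rw [one_div, Matrix.mul_smul (const (stackCol u v)), smul_smul, Matrix.add_mul, Matrix.one_mul,
    Matrix.smul_mul, Matrix.mul_assoc, Matrix.mul_add, Matrix.mul_smul, h, h2, smul_smul,
    ← add_smul, Matrix.mul_smul, smul_smul, add_assoc, ← add_smul]
  have : RatFunc.C δ⁻¹ * (t - (RatFunc.X - RatFunc.C w)) + (β - 1) * RatFunc.C δ⁻¹ *
      ((RatFunc.X - RatFunc.C w) + RatFunc.C δ⁻¹ * (t - (RatFunc.X - RatFunc.C w)) *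
        RatFunc.C δ) = 0 := by
    linear_combination RatFunc.C δ⁻¹ * hβ + (β - 1) * RatFunc.C δ⁻¹ *
      (t - (RatFunc.X - RatFunc.C w)) * hd
  rw [this, zero_smul, add_zero]

/-- One step of the recursion: an elementary factor can be extracted from a function with an
isometric realization, the dimension dropping by one. -/
theorem exists_extraction {n : ℕ} {G : RatMat (Fin p) (Fin p)}
    {A : Matrix (Fin (n + 1)) (Fin (n + 1)) ℂ} {B : Matrix (Fin (n + 1)) (Fin p) ℂ}
    {C : Matrix (Fin p) (Fin (n + 1)) ℂ} {D : Matrix (Fin p) (Fin p) ℂ}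
    (hR : (fromBlocks A B C D)ᴴ * fromBlocks A B C D = 1) (hG : Realizes G A B C D)
    (hu : ‖u‖ = 1) (hv : ‖v‖ < 1) (hw : ‖w‖ < 1) (hξ : ‖ξ‖ = 1) (hH : IsJUnitary H)
    {φ : Fin (n + 1) → ℂ} (hφ : φ = conj w • (A *ᵥ φ) + B *ᵥ WithLp.ofLp u)
    (hvφ : WithLp.ofLp v = conj w • (C *ᵥ φ) + D *ᵥ WithLp.ofLp u) :
    ∃ G', IsometricRealization (Fin n) G' ∧ G' ∈ lftDomain (theta u v w ξ H) ∧
      lft (theta u v w ξ H) G' = G := by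
  set δ : ℂ := 1 - (‖v‖ : ℂ) ^ 2 with hδ
  have hδ0 : δ ≠ 0 := one_sub_norm_sq_ne_zero hv
  have hδr : conj δ = δ := by simp [hδ]
  set b := blaschkeVal w ξ with hb
  have hbb : b * conj b = 1 := blaschkeVal_mul_conj hw hξ
  have hb0 : b ≠ 0 := left_ne_zero_of_mul_eq_one hbb
  have huu : star (WithLp.ofLp u) ⬝ᵥ WithLp.ofLp u = 1 := by
    rw [star_dotProduct_self, energy_ofLp, hu]; simp
  have hvv : star (WithLp.ofLp v) ⬝ᵥ WithLp.ofLp v = 1 - δ := by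
    rw [star_dotProduct_self, energy_ofLp, hδ]; simp
  -- The isometry polarized against the pair `(conj w φ, u)`, which it maps to `(φ, v)`. This is the
  -- interpolation condition at `w`.
  have hpol : ∀ x a, star φ ⬝ᵥ (A *ᵥ x + B *ᵥ a) + star (WithLp.ofLp v) ⬝ᵥ (C *ᵥ x + D *ᵥ a) =
      w * (star φ ⬝ᵥ x) + star (WithLp.ofLp u) ⬝ᵥ a := by
    intro x a
    have := star_dotProduct_of_isometric hR (conj w • φ) x (WithLp.ofLp u) a
    rw [Matrix.mulVec_smul, Matrix.mulVec_smul, ← hφ, ← hvφ] at this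
    rw [this, star_smul, smul_dotProduct]
    simp
  have hδf : δ = (1 - w * conj w) * (star φ ⬝ᵥ φ) := by
    have := hpol (conj w • φ) (WithLp.ofLp u)
    rw [Matrix.mulVec_smul, Matrix.mulVec_smul, ← hφ, ← hvφ, huu, hvv, dotProduct_smul,
      smul_eq_mul] at this
    linear_combination -this
  have hφ0 : φ ≠ 0 := by rintro rfl; simp at hδf; exact hδ0 hδf
  obtain ⟨Q, hQ⟩ := exists_compression hφ0
  let P : Matrix (Fin (n + 1)) (Fin (n + 1) ⊕ Fin p) ℂ := fromCols 1 0
  let P' : Matrix (Fin (n + 1)) (Fin (n + 1) ⊕ Fin p) ℂ := fromCols A B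
  let S : Matrix (Fin p ⊕ Fin p) (Fin (n + 1) ⊕ Fin p) ℂ :=
    fromRows (fromCols 0 1) (fromCols C D)
  let ρ : Matrix Unit (Fin (n + 1)) ℂ := replicateRow Unit (star φ)
  -- Along `Φ`, where `P' Φ = X P Φ`, this row becomes the scalar `b(1 - conj w X) - (X - w)` of
  -- `theta_mul_identity` times `φ* s`. Thus `W Φ` is the inverse factor applied to the graph of
  -- `G`.
  let τ : Matrix Unit (Fin (n + 1) ⊕ Fin p) ℂ :=
    b • (ρ * P - conj w • (ρ * P')) - (ρ * P' - w • (ρ * P))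
  obtain ⟨K, hK, hHK⟩ : ∃ K : Matrix (Fin p ⊕ Fin p) (Fin p ⊕ Fin p) ℂ, IsJUnitary K ∧ H * K = 1 :=
    ⟨_, hH.inv, hH.mul_inv.1⟩
  let W : Matrix (Fin p ⊕ Fin p) (Fin (n + 1) ⊕ Fin p) ℂ := K * (S + δ⁻¹ • (stackCol u v * τ))
  have hP : ∀ y, P *ᵥ y = y ∘ Sum.inl := fun y => by simp [P, fromCols_mulVec]
  have hP' : ∀ y, P' *ᵥ y = A *ᵥ (y ∘ Sum.inl) + B *ᵥ (y ∘ Sum.inr) := fun y => by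
    simp [P', fromCols_mulVec]
  have hS : ∀ y, S *ᵥ y = Sum.elim (y ∘ Sum.inr) (C *ᵥ (y ∘ Sum.inl) + D *ᵥ (y ∘ Sum.inr)) :=
    fun y => by
      simp only [S, fromRows_mulVec, fromCols_mulVec, zero_mulVec, one_mulVec, zero_add]
  have hgS : ∀ y, jForm (stack u v) (S *ᵥ y) = star φ ⬝ᵥ (P' *ᵥ y) - w * (star φ ⬝ᵥ (P *ᵥ y)) := by
    intro y
    have := hpol (y ∘ Sum.inl) (y ∘ Sum.inr)
    rw [hS, stackRow_mulVec_sumElim, hP, hP']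
    linear_combination -this
  have hτ : ∀ y, (τ *ᵥ y) () = b * (star φ ⬝ᵥ (P *ᵥ y) - conj w * (star φ ⬝ᵥ (P' *ᵥ y))) -
      (star φ ⬝ᵥ (P' *ᵥ y) - w * (star φ ⬝ᵥ (P *ᵥ y))) := by
    intro y
    have e : ∀ x, (ρ *ᵥ x) () = star φ ⬝ᵥ x := fun _ => rfl
    simp only [τ, Matrix.sub_mulVec, Matrix.smul_mulVec, ← Matrix.mulVec_mulVec, Pi.sub_apply,
      Pi.smul_apply, smul_eq_mul, e]
  have hW : ∀ y, W *ᵥ y = K *ᵥ (S *ᵥ y + (δ⁻¹ * (τ *ᵥ y) ()) • stack u v) := by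
    intro y
    change (K * (S + δ⁻¹ • (stackCol u v * τ))) *ᵥ y = _
    rw [← Matrix.mulVec_mulVec, Matrix.add_mulVec, Matrix.smul_mulVec, ← Matrix.mulVec_mulVec,
      stackCol_mulVec, smul_smul]
  -- The energy along `φ` discarded by `Q` is exactly compensated by the change of the `J`-form
  -- between `S y` and `W y`.
  have henergy : ∀ y, star ((Q * P) *ᵥ y) ⬝ᵥ ((Q * P) *ᵥ y) +
      star (W.toRows₁ *ᵥ y) ⬝ᵥ (W.toRows₁ *ᵥ y) =
      star ((Q * P') *ᵥ y) ⬝ᵥ ((Q * P') *ᵥ y) + star (W.toRows₂ *ᵥ y) ⬝ᵥ (W.toRows₂ *ᵥ y) := by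
    intro y
    have h1 := jForm_self_eq (W *ᵥ y)
    have h2 := extraction_form_identity hbb (hgS y) hδf hδ0 hδr (k := δ⁻¹ * (τ *ᵥ y) ())
      (by rw [hτ])
    rw [hW, jForm_mulVec hK, jForm_add_smul, jForm_stack hu, ← hδ, ← hW] at h1
    have h3 := star_dotProduct_of_isometric hR (y ∘ Sum.inl) (y ∘ Sum.inl) (y ∘ Sum.inr)
      (y ∘ Sum.inr)
    have h4 : jForm (S *ᵥ y) (S *ᵥ y) = star (y ∘ Sum.inr) ⬝ᵥ (y ∘ Sum.inr) -
      star (C *ᵥ (y ∘ Sum.inl) + D *ᵥ (y ∘ Sum.inr)) ⬝ᵥ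
        (C *ᵥ (y ∘ Sum.inl) + D *ᵥ (y ∘ Sum.inr)) := by rw [hS, jForm_sumElim]
    have h5 : star ((W *ᵥ y) ∘ Sum.inl) ⬝ᵥ ((W *ᵥ y) ∘ Sum.inl) =
      star (W.toRows₁ *ᵥ y) ⬝ᵥ (W.toRows₁ *ᵥ y) := rfl
    have h6 : star ((W *ᵥ y) ∘ Sum.inr) ⬝ᵥ ((W *ᵥ y) ∘ Sum.inr) =
      star (W.toRows₂ *ᵥ y) ⬝ᵥ (W.toRows₂ *ᵥ y) := rfl
    rw [h5, h6] at h1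
    rw [← Matrix.mulVec_mulVec, ← Matrix.mulVec_mulVec, hQ, hQ]
    simp only [hP, hP'] at h2 ⊢
    linear_combination -h1 - h3 + h4 + h2
  let Φ : RatMat (Fin (n + 1) ⊕ Fin p) (Fin p) := fromRows ((pencil A)⁻¹ * const B) 1
  have hΦ : ∀ {l : Type} (M : Matrix l (Fin (n + 1)) ℂ) (N : Matrix l (Fin p) ℂ),
      const (fromCols M N) * Φ = const M * ((pencil A)⁻¹ * const B) + const N := by
    intro l M N
    rw [const_fromCols, fromCols_mul_fromRows, Matrix.mul_one]
  have hPΦ : const P' * Φ = (RatFunc.X : RatFunc ℂ) • (const P * Φ) := by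
    rw [hΦ, hΦ, const_one, const_zero, add_zero, Matrix.one_mul, ← Matrix.smul_mul,
      X_smul_pencil_inv, Matrix.add_mul, Matrix.one_mul, Matrix.mul_assoc, add_comm (const B)]
  have hSΦ : const S * Φ = graph G := by
    rw [const_fromRows, fromRows_mul, hΦ, hΦ, const_one, const_zero, Matrix.zero_mul, zero_add,
      add_comm _ (const D), ← Matrix.mul_assoc, ← (hG : G = _)]
    rfl
  -- If the first block kills `c` at the test point, the energy balance with `|z| > 1` kills the
  -- second block too, so `S y` is a multiple of `[u; v]`. Pairing with `[u; v]` gives `b(1 - conj w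
  -- z) φ* s = 0`; hence that multiple vanishes and `c = 0`.
  have hM : IsUnit (const W.toRows₁ * Φ) := by
    obtain ⟨z, hz, hzw⟩ := exists_one_lt_norm w
    have hd := det_ne_zero_of_isometric hR hz
    have hΦz : MatHasVal Φ z (fromRows ((z • 1 - A)⁻¹ * B) 1) := by
      rintro (i | i) j
      · exact (((matHasVal_pencil A z).inv hd).mul (MatHasVal.const B z)) i j
      · exact MatHasVal.one i j
    refine isUnit_of_mulVec ((MatHasVal.const _ z).mul hΦz) fun c hc => ?_
    obtain ⟨s, hs, hzs, -⟩ := hG.exists_state hd c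
    set y : Fin (n + 1) ⊕ Fin p → ℂ := Sum.elim s c with hy
    have hyc : fromRows ((z • 1 - A)⁻¹ * B) 1 *ᵥ c = y := by
      rw [fromRows_mulVec, hy, hs, Matrix.one_mulVec, Matrix.mulVec_mulVec]
    rw [← Matrix.mulVec_mulVec, hyc] at hc
    have hPy : P *ᵥ y = s := by rw [hP]; rfl
    have hPy' : P' *ᵥ y = z • s := by rw [hP', hzs]; rfl
    have he := henergy y
    rw [hc, ← Matrix.mulVec_mulVec, ← Matrix.mulVec_mulVec, hPy, hPy', Matrix.mulVec_smul] at he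
    simp only [star_dotProduct_self, energy_smul] at he
    norm_cast at he
    rw [energy_eq_zero.2 rfl, add_zero] at he
    have hz2 : 1 < ‖z‖ ^ 2 := one_lt_pow₀ hz two_ne_zero
    have hW2 : energy (W.toRows₂ *ᵥ y) = 0 := by
      nlinarith [energy_nonneg (W.toRows₂ *ᵥ y), energy_nonneg (Q *ᵥ s)]
    have hW0 : W *ᵥ y = 0 := by
      ext (i | i)
      · exact congrFun hc i
      · exact congrFun (energy_eq_zero.1 hW2) i
    have hy0 : S *ᵥ y + (δ⁻¹ * (τ *ᵥ y) ()) • stack u v = 0 := by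
      have := congrArg (fun t => H *ᵥ t) ((hW y).symm.trans hW0)
      simpa only [Matrix.mulVec_mulVec, hHK, Matrix.one_mulVec,
        Matrix.mulVec_zero] using this
    have hj := congrArg (jForm (stack u v)) hy0
    rw [jForm_add_right, jForm_smul_right, jForm_stack hu, ← hδ, hgS, hτ, hPy, hPy',
      dotProduct_smul, smul_eq_mul] at hj
    have hj0 : jForm (stack u v) 0 = 0 := by simp [jForm]
    rw [hj0] at hj
    have hj2 : b * (1 - conj w * z) * (star φ ⬝ᵥ s) = 0 := by
      field_simp at hj
      linear_combination hj
    have hps : star φ ⬝ᵥ s = 0 :=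
      (mul_eq_zero.1 hj2).resolve_left (mul_ne_zero hb0 (sub_ne_zero.2 hzw.symm))
    rw [hτ, hPy, hPy', dotProduct_smul, hps] at hy0
    simp only [smul_zero, mul_zero, sub_zero, zero_smul, add_zero] at hy0
    rw [hS] at hy0
    ext i
    exact congrFun hy0 (Sum.inl i)
  refine ⟨const W.toRows₂ * Φ * (const W.toRows₁ * Φ)⁻¹, ?_, ?_⟩
  · refine isometricRealization_of_energy (Q * P) (Q * P') _ _ henergy Φ ?_ hM
    rw [const_mul, const_mul, Matrix.mul_assoc, Matrix.mul_assoc, hPΦ, Matrix.mul_smul]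
  · refine lft_eq_iff.2 ⟨(const W.toRows₁ * Φ)⁻¹, ?_, ?_⟩
    · exact (Matrix.isUnit_nonsing_inv_iff).2 hM
    have hg : graph (const W.toRows₂ * Φ * (const W.toRows₁ * Φ)⁻¹) =
        const W * Φ * (const W.toRows₁ * Φ)⁻¹ := by
      have e : const W * Φ = fromRows (const W.toRows₁ * Φ) (const W.toRows₂ * Φ) :=
        (fromRows_toRows (const W * Φ)).symm
      rw [e, fromRows_mul, Matrix.mul_nonsing_inv _ ((Matrix.isUnit_iff_isUnit_det _).1 hM)]
      rfl
    rw [hg, ← Matrix.mul_assoc]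
    congr 1
    set r : RatMat Unit (Fin p) := const ρ * (const P * Φ) with hr
    have hrow : const (stackRow u v) * graph G = (RatFunc.X - RatFunc.C w) • r := by
      have e : stackRow u v * S = ρ * P' - w • (ρ * P) := by
        apply Matrix.mulVec_injective
        ext1 y
        ext i
        rw [← Matrix.mulVec_mulVec, stackRow_mulVec, hgS]
        simp only [Matrix.sub_mulVec, Matrix.smul_mulVec, ← Matrix.mulVec_mulVec]
        rfl
      rw [← hSΦ, ← Matrix.mul_assoc, ← const_mul, e, const_sub, const_smul, Matrix.sub_mul,
        Matrix.smul_mul, const_mul, const_mul, Matrix.mul_assoc, Matrix.mul_assoc, hPΦ,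
        Matrix.mul_smul, ← hr, sub_smul]
    have hτΦ : const τ * Φ = (RatFunc.C b * (1 - RatFunc.C (conj w) * RatFunc.X) -
        (RatFunc.X - RatFunc.C w)) • r := by
      simp only [τ, const_sub, const_smul, const_mul, Matrix.sub_mul, Matrix.smul_mul]
      rw [Matrix.mul_assoc, Matrix.mul_assoc, hPΦ, Matrix.mul_smul, ← hr]
      ext i j
      simp only [Matrix.sub_apply, Matrix.smul_apply, smul_eq_mul]
      ring
    have hWΦ : const W * Φ = const K * (graph G + RatFunc.C δ⁻¹ •
        (const (stackCol u v) * (const τ * Φ))) := by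
      rw [← hSΦ, ← Matrix.mul_assoc (const (stackCol u v)), ← const_mul, ← Matrix.smul_mul,
        ← const_smul, ← Matrix.add_mul, ← const_add, ← Matrix.mul_assoc, ← const_mul]
    have hHKc : const H * const K = 1 := by rw [← const_mul, hHK, const_one]
    rw [hWΦ, theta_eq, ← Matrix.mul_assoc, Matrix.mul_assoc _ (const H), hHKc,
      Matrix.mul_one, hτΦ, theta_mul_identity hu hv hw hξ hrow]

end Extraction

/-! ### Composition with an elementary factor -/

section Composition
variable {p : ℕ} {u v : Vec p} {w ξ : ℂ} {H : Matrix (Fin p ⊕ Fin p) (Fin p ⊕ Fin p) ℂ}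

/-- The added state has value `s`, next value `t` and input `g`. The identity says that the `J`-form
changes by exactly the energy `|t|² - |s|²` gained by this state; the key relation is `c(δk + g) =
conj b (t - w s)`. -/
theorem composition_form_identity {b w s t g δ k c : ℂ} (hb : b * conj b = 1) (hc0 : c ≠ 0)
    (hc : conj c = c) (hδ0 : δ ≠ 0) (hδ : conj δ = δ) (hcδ : c ^ 2 * δ = 1 - w * conj w)
    (hs : s = conj w * t + c * g)
    (hk : k = (c * δ)⁻¹ * (conj b * (t - w * s) - (s - conj w * t))) :
    k * conj g + conj k * g + k * conj k * δ = t * conj t - s * conj s := by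
  have h1 : c * (δ * k + g) = conj b * (t - w * s) := by
    have : c * δ * k = conj b * (t - w * s) - (s - conj w * t) := by rw [hk]; field_simp
    linear_combination this - hs
  have h2 : c * (δ * conj k + conj g) = b * (conj t - conj w * conj s) := by
    have := congrArg conj h1
    simpa [hc, hδ] using this
  have h3 : conj s = w * conj t + c * conj g := by
    have := congrArg conj hs
    simpa [hc] using this
  apply mul_left_cancel₀ (mul_ne_zero (pow_ne_zero 2 hc0) hδ0)
  linear_combination c * (δ * conj k + conj g) * h1 + conj b * (t - w * s) * h2 +
    (t - w * s) * (conj t - conj w * conj s) * hb + c * conj g * hs +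
    (s - conj w * t) * h3 - (t * conj t - s * conj s) * hcδ

/-- Applying the linear fractional transformation of an elementary factor increases the dimension
of a realization by at most one. -/
theorem hasRealization_of_lft {σ : Type} [Fintype σ] [DecidableEq σ] {G G' : RatMat (Fin p) (Fin p)}
    (hG' : IsometricRealization σ G')
    (hu : ‖u‖ = 1) (hv : ‖v‖ < 1) (hw : ‖w‖ < 1) (hξ : ‖ξ‖ = 1) (hH : IsJUnitary H)
    (h : G' ∈ lftDomain (theta u v w ξ H) ∧ lft (theta u v w ξ H) G' = G) :
    HasRealization G (Fintype.card σ + 1) := by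
  obtain ⟨A, B, C, D, hR, hG⟩ := hG'
  obtain ⟨N, hN, hlft⟩ := lft_eq_iff.1 h
  set δ : ℂ := 1 - (‖v‖ : ℂ) ^ 2 with hδ
  have hδ0 : δ ≠ 0 := one_sub_norm_sq_ne_zero hv
  have hδr : conj δ = δ := by simp [hδ]
  set b := blaschkeVal w ξ with hb
  have hbb : b * conj b = 1 := blaschkeVal_mul_conj hw hξ
  have hb0 : b ≠ 0 := left_ne_zero_of_mul_eq_one hbb
  -- The normalization of the new state which makes the energy balance hold.
  obtain ⟨c, hc0, hcr, hcδ⟩ : ∃ c : ℂ, c ≠ 0 ∧ conj c = c ∧ c ^ 2 * δ = 1 - w * conj w := by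
    have h1 : 0 < 1 - ‖w‖ ^ 2 := by nlinarith [norm_nonneg w]
    have h2 : 0 < 1 - ‖v‖ ^ 2 := by nlinarith [norm_nonneg v]
    have h3 : 0 < (1 - ‖w‖ ^ 2) / (1 - ‖v‖ ^ 2) := div_pos h1 h2
    refine ⟨(Real.sqrt ((1 - ‖w‖ ^ 2) / (1 - ‖v‖ ^ 2)) : ℂ), ?_, Complex.conj_ofReal _, ?_⟩
    · exact_mod_cast (Real.sqrt_pos.2 h3).ne'
    · rw [← Complex.ofReal_pow, Real.sq_sqrt h3.le, Complex.mul_conj', hδ]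
      have : (1 - (‖v‖ : ℂ) ^ 2) ≠ 0 := hδ0
      push_cast
      field_simp
  let P : Matrix σ ((σ ⊕ Fin p) ⊕ Unit) ℂ := fromCols (fromCols 1 0) 0
  let P' : Matrix σ ((σ ⊕ Fin p) ⊕ Unit) ℂ := fromCols (fromCols A B) 0
  let S : Matrix (Fin p ⊕ Fin p) ((σ ⊕ Fin p) ⊕ Unit) ℂ := fromCols (fromRows (fromCols 0 1) (fromCols C D)) 0
  let t : Matrix Unit ((σ ⊕ Fin p) ⊕ Unit) ℂ := fromCols 0 1
  let γ : Matrix Unit ((σ ⊕ Fin p) ⊕ Unit) ℂ := stackRow u v * (H * S)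
  -- The free extra variable is the next value `t`, not the current one. With `t = X s` the relation
  -- reads `(1 - conj w X) s = c γ`, so the state carries the pole `1 / conj w` of the Blaschke
  -- factor without dividing by `conj w`.
  let s : Matrix Unit ((σ ⊕ Fin p) ⊕ Unit) ℂ := conj w • t + c • γ
  let κ : Matrix Unit ((σ ⊕ Fin p) ⊕ Unit) ℂ := (c * δ)⁻¹ • (conj b • (t - w • s) - (s - conj w • t))
  let W : Matrix (Fin p ⊕ Fin p) ((σ ⊕ Fin p) ⊕ Unit) ℂ := H * S + stackCol u v * κ
  have hP : ∀ y, P *ᵥ y = (y ∘ Sum.inl) ∘ Sum.inl := fun y => by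
    simp only [P, fromCols_mulVec, zero_mulVec, one_mulVec, add_zero]
  have hP' : ∀ y, P' *ᵥ y = A *ᵥ ((y ∘ Sum.inl) ∘ Sum.inl) + B *ᵥ ((y ∘ Sum.inl) ∘ Sum.inr) :=
    fun y => by simp only [P', fromCols_mulVec, zero_mulVec, add_zero]
  have hS : ∀ y, S *ᵥ y = Sum.elim ((y ∘ Sum.inl) ∘ Sum.inr)
      (C *ᵥ ((y ∘ Sum.inl) ∘ Sum.inl) + D *ᵥ ((y ∘ Sum.inl) ∘ Sum.inr)) := fun y => by
    simp only [S, fromRows_mulVec, fromCols_mulVec, zero_mulVec, one_mulVec, zero_add, add_zero]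
  have hγ : ∀ y, (γ *ᵥ y) () = jForm (stack u v) (H *ᵥ (S *ᵥ y)) := by
    intro y
    rw [← stackRow_mulVec _ (), Matrix.mulVec_mulVec, Matrix.mulVec_mulVec, Matrix.mul_assoc]
  have hs : ∀ y, (s *ᵥ y) () = conj w * (t *ᵥ y) () + c * (γ *ᵥ y) () := by
    intro y
    simp only [s, Matrix.add_mulVec, Matrix.smul_mulVec, Pi.add_apply, Pi.smul_apply, smul_eq_mul]
  have hκ : ∀ y, (κ *ᵥ y) () = (c * δ)⁻¹ * (conj b * ((t *ᵥ y) () - w * (s *ᵥ y) ()) -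
      ((s *ᵥ y) () - conj w * (t *ᵥ y) ())) := by
    intro y
    simp only [κ, Matrix.sub_mulVec, Matrix.smul_mulVec, Pi.sub_apply, Pi.smul_apply, smul_eq_mul]
  have hW : ∀ y, W *ᵥ y = H *ᵥ (S *ᵥ y) + (κ *ᵥ y) () • stack u v := by
    intro y
    change (H * S + stackCol u v * κ) *ᵥ y = _
    rw [Matrix.add_mulVec, ← Matrix.mulVec_mulVec, ← Matrix.mulVec_mulVec, stackCol_mulVec]
  have henergy : ∀ y, star (fromRows P s *ᵥ y) ⬝ᵥ (fromRows P s *ᵥ y) +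
      star (W.toRows₁ *ᵥ y) ⬝ᵥ (W.toRows₁ *ᵥ y) =
      star (fromRows P' t *ᵥ y) ⬝ᵥ (fromRows P' t *ᵥ y) +
      star (W.toRows₂ *ᵥ y) ⬝ᵥ (W.toRows₂ *ᵥ y) := by
    intro y
    have e : ∀ (M : Matrix σ ((σ ⊕ Fin p) ⊕ Unit) ℂ) (L : Matrix Unit ((σ ⊕ Fin p) ⊕ Unit) ℂ),
        star (fromRows M L *ᵥ y) ⬝ᵥ (fromRows M L *ᵥ y) =
        star (M *ᵥ y) ⬝ᵥ (M *ᵥ y) + (L *ᵥ y) () * conj ((L *ᵥ y) ()) := by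
      intro M L
      simp [fromRows_mulVec, dotProduct, Fintype.sum_sum_type, mul_comm]
    rw [e, e]
    have h1 := jForm_self_eq (W *ᵥ y)
    have h2 := composition_form_identity hbb hc0 hcr hδ0 hδr hcδ (hs y) (hκ y)
    rw [hW, jForm_add_smul, jForm_mulVec hH, jForm_stack hu, ← hδ, ← hγ, ← hW] at h1
    have h3 := star_dotProduct_of_isometric hR ((y ∘ Sum.inl) ∘ Sum.inl)
      ((y ∘ Sum.inl) ∘ Sum.inl) ((y ∘ Sum.inl) ∘ Sum.inr) ((y ∘ Sum.inl) ∘ Sum.inr)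
    have h4 := jForm_sumElim ((y ∘ Sum.inl) ∘ Sum.inr)
      (C *ᵥ ((y ∘ Sum.inl) ∘ Sum.inl) + D *ᵥ ((y ∘ Sum.inl) ∘ Sum.inr)) ((y ∘ Sum.inl) ∘ Sum.inr)
      (C *ᵥ ((y ∘ Sum.inl) ∘ Sum.inl) + D *ᵥ ((y ∘ Sum.inl) ∘ Sum.inr))
    rw [← hS] at h4
    have h5 : star ((W *ᵥ y) ∘ Sum.inl) ⬝ᵥ ((W *ᵥ y) ∘ Sum.inl) =
      star (W.toRows₁ *ᵥ y) ⬝ᵥ (W.toRows₁ *ᵥ y) := rfl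
    have h6 : star ((W *ᵥ y) ∘ Sum.inr) ⬝ᵥ ((W *ᵥ y) ∘ Sum.inr) =
      star (W.toRows₂ *ᵥ y) ⬝ᵥ (W.toRows₂ *ᵥ y) := rfl
    rw [h5, h6] at h1
    rw [hP, hP']
    linear_combination -h1 - h3 + h4 + h2
  set g₀ : RatMat Unit (Fin p) := const (stackRow u v) * (const H * graph G') with hg₀
  set d : RatFunc ℂ := 1 - RatFunc.C (conj w) * RatFunc.X with hd
  have hd0 : d ≠ 0 := blaschke_denom_ne_zero w
  let sΦ : RatMat Unit (Fin p) := (RatFunc.C c / d) • g₀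
  let Φ : RatMat ((σ ⊕ Fin p) ⊕ Unit) (Fin p) := fromRows (fromRows ((pencil A)⁻¹ * const B) 1)
    ((RatFunc.X : RatFunc ℂ) • sΦ)
  have hΦ : ∀ {l : Type} (M : Matrix l σ ℂ) (L : Matrix l (Fin p) ℂ) (L' : Matrix l Unit ℂ),
      const (fromCols (fromCols M L) L') * Φ =
      const M * ((pencil A)⁻¹ * const B) + const L + const L' * ((RatFunc.X : RatFunc ℂ) • sΦ) := by
    intro l M L L'
    rw [const_fromCols, const_fromCols, fromCols_mul_fromRows, fromCols_mul_fromRows,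
      Matrix.mul_one]
  have hPΦ : const P' * Φ = (RatFunc.X : RatFunc ℂ) • (const P * Φ) := by
    rw [hΦ, hΦ, const_one, const_zero, const_zero, Matrix.zero_mul, add_zero, add_zero, add_zero,
      Matrix.one_mul, ← Matrix.smul_mul,
      X_smul_pencil_inv, Matrix.add_mul, Matrix.one_mul, Matrix.mul_assoc, add_comm (const B)]
  have hSΦ : const S * Φ = graph G' := by
    have e : S = fromRows (fromCols (fromCols 0 1) 0) (fromCols (fromCols C D) 0) := by
      ext (i | i) ((j | j) | j) <;> rfl
    rw [e, const_fromRows, fromRows_mul, hΦ, hΦ, const_one, const_zero, const_zero,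
      Matrix.zero_mul, Matrix.zero_mul, zero_add, add_zero, add_zero,
      add_comm _ (const D), ← Matrix.mul_assoc, ← (hG : G' = _)]
    rfl
  have htΦ : const t * Φ = (RatFunc.X : RatFunc ℂ) • sΦ := by
    rw [const_fromCols, fromCols_mul_fromRows, const_zero, const_one, Matrix.zero_mul, zero_add,
      Matrix.one_mul]
  have hγΦ : const γ * Φ = g₀ := by
    rw [hg₀, ← hSΦ, const_mul, const_mul, Matrix.mul_assoc, Matrix.mul_assoc]
  have hsΦ : const s * Φ = sΦ := by
    rw [const_add, const_smul, const_smul, Matrix.add_mul, Matrix.smul_mul, Matrix.smul_mul, htΦ,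
      hγΦ, smul_smul, smul_smul, ← add_smul]
    congr 1
    field_simp
    rw [hd]; ring
  have hκΦ : const κ * Φ = ((blaschke w / RatFunc.C b - 1) * RatFunc.C (1 / δ)) • g₀ := by
    have e : const κ * Φ = RatFunc.C (c * δ)⁻¹ • (RatFunc.C (conj b) • ((RatFunc.X : RatFunc ℂ) • sΦ -
        RatFunc.C w • sΦ) - (sΦ - RatFunc.C (conj w) • ((RatFunc.X : RatFunc ℂ) • sΦ))) := by
      rw [← htΦ, ← hsΦ]
      simp only [κ, const_smul, const_sub, Matrix.smul_mul, Matrix.sub_mul]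
    rw [e]
    ext i j
    simp only [Matrix.sub_apply, Matrix.smul_apply, smul_eq_mul, sΦ]
    have hcb : RatFunc.C (conj b) * RatFunc.C b = 1 := by
      rw [← map_mul, mul_comm, hbb, map_one]
    have hbC : RatFunc.C b ≠ 0 := right_ne_zero_of_mul_eq_one hcb
    have hcC : RatFunc.C c ≠ 0 := by simpa using hc0
    have hδC : RatFunc.C δ ≠ 0 := by simpa using hδ0
    have hcb' : RatFunc.C (conj b) = (RatFunc.C b)⁻¹ := eq_inv_of_mul_eq_one_left hcb
    have hbl : blaschke w = (RatFunc.X - RatFunc.C w) / d := rfl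
    rw [hcb', hbl, one_div, map_inv₀, map_inv₀, map_mul]
    field_simp
    rw [hd]; ring
  have hWΦ : const W * Φ = graph G * N := by
    rw [← hlft, theta_eq, ← hδ, ← hb, const_add, const_mul, const_mul, Matrix.add_mul,
      Matrix.mul_assoc, hSΦ, Matrix.mul_assoc, hκΦ, Matrix.mul_assoc, Matrix.add_mul,
      Matrix.one_mul, Matrix.smul_mul, Matrix.mul_assoc, ← hg₀, Matrix.mul_smul]
  rw [graph_mul] at hWΦ
  have hW1 : const W.toRows₁ * Φ = N := by
    have := congrArg toRows₁ hWΦ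
    rwa [toRows₁_fromRows] at this
  have hW2 : const W.toRows₂ * Φ = G * N := by
    have := congrArg toRows₂ hWΦ
    rwa [toRows₂_fromRows] at this
  have key := isometricRealization_of_energy (fromRows P s) (fromRows P' t) W.toRows₁ W.toRows₂
    henergy Φ (by
      rw [const_fromRows, const_fromRows, fromRows_mul, fromRows_mul, hPΦ, htΦ, hsΦ]
      ext (i | i) j <;> rfl) (by rw [hW1]; exact hN)
  rw [hW1, hW2, Matrix.mul_assoc, Matrix.mul_nonsing_inv _ ((Matrix.isUnit_iff_isUnit_det _).1 hN),
    Matrix.mul_one] at key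
  simpa using key.hasRealization

end Composition

/-! ### One step of the algorithm -/

section Step
variable {p n : ℕ} {G : RatMat (Fin p) (Fin p)} {w ξ : ℂ}

theorem ofLp_schurVec (G : RatMat (Fin p) (Fin p)) (w : ℂ) (u : Vec p) :
    WithLp.ofLp (schurVec G w u) = matValueAt G (invConj w) *ᵥ WithLp.ofLp u := rfl

/-- A lossless function of positive McMillan degree maps some unit vector to a vector of norm less
than one at each point outside the closed unit disk. -/
theorem exists_norm_schurVec_lt_one (hG : IsLossless G) (hn : HasMcMillanDegree G n) (h0 : 1 ≤ n)
    (hw : ‖w‖ < 1) : ∃ x : Vec p, ‖x‖ = 1 ∧ ‖schurVec G w x‖ < 1 := by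
  by_contra! hcon
  obtain ⟨A, B, C, D, hR, hGR⟩ := hG.isometricRealization hn
  have hB1 : ∀ x : Vec p, ‖x‖ = 1 → B *ᵥ WithLp.ofLp x = 0 := by
    intro x hx
    obtain ⟨φ, hφ, hv⟩ := (value_invConj_of_isometric hR hGR hw).2 (WithLp.ofLp x)
    -- The balance `|w|²‖φ‖² + 1 = ‖φ‖² + ‖v‖²` with `‖v‖ ≥ 1` and `|w| < 1` forces `φ = 0`, hence
    -- `Bx = 0`.
    have h1 := energy_of_isometric hR (conj w • φ) (WithLp.ofLp x)
    rw [Matrix.mulVec_smul, Matrix.mulVec_smul, ← hφ, ← hv, ← ofLp_schurVec,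
      energy_ofLp (schurVec G w x), energy_ofLp x, energy_smul, RCLike.norm_conj, hx] at h1
    have h2 : 1 ≤ ‖schurVec G w x‖ ^ 2 := one_le_pow₀ (hcon x hx)
    have h3 : ‖w‖ ^ 2 < 1 := pow_lt_one₀ (norm_nonneg w) hw two_ne_zero
    have h4 : energy φ = 0 := by nlinarith [energy_nonneg φ]
    have h5 := energy_eq_zero.1 h4
    rw [h5] at hφ
    simpa using hφ.symm
  have hB : B = 0 := by
    ext i j
    have := congrFun (hB1 (EuclideanSpace.single j 1) (by simp)) i
    simpa using this
  have h1 : HasRealization G 0 := ⟨0, 0, 0, D, by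
    have : G = const D + const C * (pencil A)⁻¹ * const B := hGR
    rw [this, hB]; simp [const_zero]⟩
  have := hn.2 h1
  omega

theorem exists_hasMcMillanDegree_le {q d : ℕ} {G : RatMat (Fin p) (Fin q)}
    (h : HasRealization G d) : ∃ d' ≤ d, HasMcMillanDegree G d' := by
  classical
  have hex : ∃ d, HasRealization G d := ⟨d, h⟩
  exact ⟨Nat.find hex, Nat.find_min' hex h, Nat.find_spec hex, fun _ hk => Nat.find_min' hex hk⟩

/-- A step of the tangential Schur algorithm lowers the McMillan degree by one. -/
theorem schur_step (hG : IsLossless G) (hn : HasMcMillanDegree G (n + 1)) {u : Vec p}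
    {H : Matrix (Fin p ⊕ Fin p) (Fin p ⊕ Fin p) ℂ} (hu : ‖u‖ = 1) (hv : ‖schurVec G w u‖ < 1)
    (hw : ‖w‖ < 1) (hξ : ‖ξ‖ = 1) (hH : IsJUnitary H) :
    MatAnalyticAt G (invConj w) ∧
    (lftInv (theta u (schurVec G w u) w ξ H) G ∈ lftDomain (theta u (schurVec G w u) w ξ H) ∧
      lft (theta u (schurVec G w u) w ξ H) (lftInv (theta u (schurVec G w u) w ξ H) G) = G) ∧
    IsLossless (lftInv (theta u (schurVec G w u) w ξ H) G) ∧
    HasMcMillanDegree (lftInv (theta u (schurVec G w u) w ξ H) G) n := by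
  obtain ⟨A, B, C, D, hR, hGR⟩ := hG.isometricRealization hn
  obtain ⟨han, hval⟩ := value_invConj_of_isometric hR hGR hw
  obtain ⟨φ, hφ, hvφ⟩ := hval (WithLp.ofLp u)
  obtain ⟨G', hiso, hdom, hlft⟩ := exists_extraction hR hGR hu hv hw hξ hH hφ hvφ
  rw [lftInv_eq (isUnit_theta hu hv hw hξ hH) hdom hlft]
  refine ⟨han, ⟨hdom, hlft⟩, hiso.isLossless, by simpa using hiso.hasRealization, fun d hd => ?_⟩
  -- The composition bound needs an isometric realization, which is available only in the minimal
  -- dimension `d'`. Putting the factor back realizes `G` in dimension `d' + 1`, so `n + 1 ≤ d' +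
  -- 1`.
  obtain ⟨d', hd', hmin⟩ := exists_hasMcMillanDegree_le hd
  have := hn.2 (hasRealization_of_lft (hiso.isLossless.isometricRealization hmin)
    hu hv hw hξ hH ⟨hdom, hlft⟩)
  rw [Fintype.card_fin] at this
  omega

theorem exists_unitary_of_degree_zero (hG : IsLossless G) (hn : HasMcMillanDegree G 0) :
    ∃ U ∈ Matrix.unitaryGroup (Fin p) ℂ, G = const U := by
  obtain ⟨A, B, C, D, hR, hGR⟩ := hG.isometricRealization hn
  refine ⟨D, ?_, ?_⟩
  · rw [Matrix.mem_unitaryGroup_iff', Matrix.star_eq_conjTranspose]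
    rw [fromBlocks_conjTranspose, fromBlocks_multiply, ← fromBlocks_one, fromBlocks_inj] at hR
    have hB : Bᴴ * B = 0 := by ext; simp [Matrix.mul_apply]
    simpa [hB] using hR.2.2.2
  · have : G = const D + const C * (pencil A)⁻¹ * const B := hGR
    rw [this]
    ext i j
    simp

end Step

/-! ### The recursion -/

section Recursion
variable {p : ℕ} {n : ℕ} {G : RatMat (Fin p) (Fin p)} {w ξ : ℕ → ℂ}
  {H : ℕ → Vec p → Vec p → ℂ → ℂ → Matrix (Fin p ⊕ Fin p) (Fin p ⊕ Fin p) ℂ} {u u' : ℕ → Vec p}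

theorem schurDown_congr (j : ℕ) (h : ∀ i < j, u (n - i) = u' (n - i)) :
    schurDown n G w ξ H u j = schurDown n G w ξ H u' j := by
  induction j with
  | zero => rfl
  | succ j ih =>
    simp only [schurDown]
    rw [ih fun i hi => h i (by omega), h j (by omega)]

/-- The function `G^(k)` depends only on the choices made at the levels above `k`. -/
theorem schurG_congr {k : ℕ} (h : ∀ j, k < j → j ≤ n → u j = u' j) :
    schurG n G w ξ H u k = schurG n G w ξ H u' k :=
  schurDown_congr _ fun i hi => h _ (by omega) (by omega)

theorem admissible_congr {k : ℕ} (h : ∀ j, k ≤ j → j ≤ n → u j = u' j) (hk : k ≤ n) :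
    Admissible n G w ξ H u k ↔ Admissible n G w ξ H u' k := by
  unfold Admissible schurV
  rw [schurG_congr fun j hj hjn => h j hj.le hjn, h k le_rfl hk]

variable (hG : IsLossless G) (hdeg : HasMcMillanDegree G n)
    (hw : ∀ k, 1 ≤ k → k ≤ n → ‖w k‖ < 1)
    (hξ : ∀ k, 1 ≤ k → k ≤ n → ‖ξ k‖ = 1)
    (hH : ∀ k, 1 ≤ k → k ≤ n → ∀ (a b : Vec p) (c d : ℂ),
      ‖a‖ = 1 → ‖b‖ < 1 → ‖c‖ < 1 → ‖d‖ = 1 → IsJUnitary (H k a b c d))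
include hG hdeg hw hξ hH

theorem schurG_lossless {k : ℕ} (hk : k ≤ n)
    (hu : ∀ j, k < j → j ≤ n → Admissible n G w ξ H u j) :
    IsLossless (schurG n G w ξ H u k) ∧ HasMcMillanDegree (schurG n G w ξ H u k) k := by
  induction hk using Nat.decreasingInduction with
  | self => rw [schurG_top]; exact ⟨hG, hdeg⟩
  | of_succ k hk ih =>
    obtain ⟨h1, h2⟩ := ih fun j hj => hu j (by omega)
    obtain ⟨hu1, hv1⟩ := hu (k + 1) (by omega) hk
    have hw1 := hw (k + 1) (by omega) hk
    have hξ1 := hξ (k + 1) (by omega) hk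
    have hs := schurG_step n G w ξ H u (k + 1) (by omega) hk
    rw [Nat.add_sub_cancel] at hs
    rw [hs]
    exact (schur_step h1 h2 hu1 hv1 hw1 hξ1
      (hH (k + 1) (by omega) hk _ _ _ _ hu1 hv1 hw1 hξ1)).2.2

theorem schurG_lft {k : ℕ} (h1k : 1 ≤ k) (hk : k ≤ n)
    (hu : ∀ j, k ≤ j → j ≤ n → Admissible n G w ξ H u j) :
    MatAnalyticAt (schurG n G w ξ H u k) (invConj (w k)) ∧
      (schurG n G w ξ H u (k - 1) ∈ lftDomain (schurTheta n G w ξ H u k) ∧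
        lft (schurTheta n G w ξ H u k) (schurG n G w ξ H u (k - 1)) = schurG n G w ξ H u k) := by
  obtain ⟨h1, h2⟩ := schurG_lossless hG hdeg hw hξ hH hk fun j hj => hu j hj.le
  obtain ⟨hu1, hv1⟩ := hu k le_rfl hk
  have hw1 := hw k h1k hk
  have hξ1 := hξ k h1k hk
  rw [schurG_step n G w ξ H u k h1k hk]
  obtain ⟨m, rfl⟩ : ∃ m, k = m + 1 := ⟨k - 1, by omega⟩
  have := schur_step h1 h2 hu1 hv1 hw1 hξ1 (hH _ h1k hk _ _ _ _ hu1 hv1 hw1 hξ1)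
  exact ⟨this.1, this.2.1⟩

theorem exists_admissible_update {k : ℕ} (h1k : 1 ≤ k) (hk : k ≤ n)
    (hu : ∀ j, k < j → j ≤ n → Admissible n G w ξ H u j) :
    ∃ x : Vec p, Admissible n G w ξ H (Function.update u k x) k := by
  obtain ⟨h1, h2⟩ := schurG_lossless hG hdeg hw hξ hH hk hu
  obtain ⟨x, hx1, hx2⟩ := exists_norm_schurVec_lt_one h1 h2 h1k (hw k h1k hk)
  refine ⟨x, ?_⟩
  -- The vector at level `k` enters only in passing from `G^(k)` to `G^(k-1)`, so changing it leaves
  -- `G^(k)` untouched.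
  have e : schurG n G w ξ H (Function.update u k x) k = schurG n G w ξ H u k :=
    schurG_congr fun j hj _ => Function.update_of_ne (by omega) _ _
  unfold Admissible schurV
  rw [e, Function.update_self]
  exact ⟨hx1, hx2⟩

theorem exists_admissible {k : ℕ} (hk : k ≤ n) :
    ∃ u : ℕ → Vec p, ∀ j, k < j → j ≤ n → Admissible n G w ξ H u j := by
  induction hk using Nat.decreasingInduction with
  | self => exact ⟨0, fun j h1 h2 => by omega⟩
  | of_succ k hk ih =>
    obtain ⟨u, hu⟩ := ih
    obtain ⟨x, hx⟩ := exists_admissible_update hG hdeg hw hξ hH (by omega) hk hu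
    refine ⟨Function.update u (k + 1) x, fun j hj hjn => ?_⟩
    rcases eq_or_lt_of_le (Nat.succ_le_of_lt hj) with rfl | hlt
    · exact hx
    · refine (admissible_congr (fun i hi _ => ?_) hjn).2 (hu j hlt hjn)
      exact Function.update_of_ne (by omega) _ _

theorem schurG_lftComp (hu : ∀ j, 1 ≤ j → j ≤ n → Admissible n G w ξ H u j) {k : ℕ} (hk : k ≤ n) :
    lftComp (schurTheta n G w ξ H u) k (schurG n G w ξ H u 0) = schurG n G w ξ H u k := by
  induction k with
  | zero => rfl
  | succ k ih =>
    rw [lftComp, ih (by omega)]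
    exact (schurG_lft hG hdeg hw hξ hH (by omega) hk fun j hj => hu j (by omega)).2.2

theorem schurG_lft_thetaProd (hu : ∀ j, 1 ≤ j → j ≤ n → Admissible n G w ξ H u j) {k : ℕ}
    (hk : k ≤ n) :
    schurG n G w ξ H u 0 ∈ lftDomain (thetaProd (schurTheta n G w ξ H u) k) ∧
      lft (thetaProd (schurTheta n G w ξ H u) k) (schurG n G w ξ H u 0) =
        schurG n G w ξ H u k := by
  induction k with
  | zero => exact lft_one
  | succ k ih =>
    exact lft_mul (ih (by omega))
      (schurG_lft hG hdeg hw hξ hH (by omega) hk fun j hj => hu j (by omega)).2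

end Recursion

end TangentialSchur

theorem theorem5p5 (p n : ℕ) (G : RatMat (Fin p) (Fin p))
    (hG : IsLossless G) (hdeg : HasMcMillanDegree G n)
    (w ξ : ℕ → ℂ)
    (hw : ∀ k, 1 ≤ k → k ≤ n → ‖w k‖ < 1)
    (hξ : ∀ k, 1 ≤ k → k ≤ n → ‖ξ k‖ = 1)
    (H : ℕ → Vec p → Vec p → ℂ → ℂ → Matrix (Fin p ⊕ Fin p) (Fin p ⊕ Fin p) ℂ)
    (hH : ∀ k, 1 ≤ k → k ≤ n → ∀ (a b : Vec p) (c d : ℂ),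
      ‖a‖ = 1 → ‖b‖ < 1 → ‖c‖ < 1 → ‖d‖ = 1 → IsJUnitary (H k a b c d)) :
    -- existence of admissible unit vectors
    (∃ u : ℕ → Vec p, ∀ k, 1 ≤ k → k ≤ n → Admissible n G w ξ H u k) ∧
    -- the choices can be made one after the other, for `k = n, …, 1`
    (∀ u : ℕ → Vec p, ∀ k, 1 ≤ k → k ≤ n →
      (∀ j, k < j → j ≤ n → Admissible n G w ξ H u j) →
      ∃ x : Vec p, Admissible n G w ξ H (Function.update u k x) k) ∧
    -- consequences of any admissible choice
    (∀ u : ℕ → Vec p, (∀ k, 1 ≤ k → k ≤ n → Admissible n G w ξ H u k) →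
      (∀ k, k ≤ n → IsLossless (schurG n G w ξ H u k) ∧
        HasMcMillanDegree (schurG n G w ξ H u k) k) ∧
      (∀ k, 1 ≤ k → k ≤ n →
        MatAnalyticAt (schurG n G w ξ H u k) (invConj (w k)) ∧
        schurG n G w ξ H u (k - 1) ∈ lftDomain (schurTheta n G w ξ H u k) ∧
        lft (schurTheta n G w ξ H u k) (schurG n G w ξ H u (k - 1)) =
          schurG n G w ξ H u k) ∧
      G = lftComp (schurTheta n G w ξ H u) n (schurG n G w ξ H u 0) ∧
      schurG n G w ξ H u 0 ∈ lftDomain (thetaProd (schurTheta n G w ξ H u) n) ∧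
      G = lft (thetaProd (schurTheta n G w ξ H u) n) (schurG n G w ξ H u 0) ∧
      ∃ U ∈ Matrix.unitaryGroup (Fin p) ℂ, schurG n G w ξ H u 0 = const U) := by
  refine ⟨?_, fun u k h1k hk hu => exists_admissible_update hG hdeg hw hξ hH h1k hk hu,
    fun u hu => ?_⟩
  · obtain ⟨u, hu⟩ := exists_admissible hG hdeg hw hξ hH (Nat.zero_le n)
    exact ⟨u, fun k h1k => hu k h1k⟩
  · have hloss : ∀ k, k ≤ n → IsLossless (schurG n G w ξ H u k) ∧
        HasMcMillanDegree (schurG n G w ξ H u k) k := fun k hk =>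
      schurG_lossless hG hdeg hw hξ hH hk fun j hj => hu j (by omega)
    have htop := schurG_top n G w ξ H u
    have hprod := schurG_lft_thetaProd hG hdeg hw hξ hH hu le_rfl
    refine ⟨hloss, fun k h1k hk => schurG_lft hG hdeg hw hξ hH h1k hk fun j hj =>
      hu j (by omega), ?_, hprod.1, ?_, ?_⟩
    · rw [schurG_lftComp hG hdeg hw hξ hH hu le_rfl, htop]
    · rw [hprod.2, htop]
    · exact exists_unitary_of_degree_zero (hloss 0 (Nat.zero_le n)).1 (hloss 0 (Nat.zero_le n)).2
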